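/- Let $B>0$, $R>0$ and let $\alpha_n,\beta_n\in\mathbb R$ ($n\in\mathbb Z$) be arbitrary. For $i\in\{1,2\}$ put $s_1=1$, $s_2=-1$, and for $n\in\mathbb Z$, $\gamma\in\mathbb R$ let $h^{i,\gamma}_{n}$ be the operator $$-\frac{d^2}{dr^2}+\Big(\frac nr+\frac B2 r\Big)^2-\frac1{4r^2}+s_iB$$ in $L^2((0,\infty),dr)$ whose domain consists of all $f\in L^2((0,\infty))\cap H^{2}_{loc}((0,\infty)\setminus\{R\})$ such that the above expression applied to $f$ (off $R$) is in $L^2((0,\infty))$, $f'(R_+)=f'(R_-)=:f'(R)$, $f(R_+)-f(R_-)=\gamma f'(R)$ and, if $n=0$, $\lim_{r\to0+}f(r)/(\sqrt r\ln r)=0$. For $m,m'\in\mathbb Z$ let $$H^{G}_{m,m'}=\mathrm{diag}(h^{1,\alpha_m}_{m},h^{2,\beta_{m'}}_{m'})$$ in $L^2((0,\infty))\otimes\mathbb C^2$, where $G_{m,m'}=\mathrm{diag}(\alpha_m,\beta_{m'})$, and let $H^{O}_{m,m'}$ be the operator with $G_{m,m'}=0$. Let $$e_n:L^2((0,\infty),dr)\to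 L^2(\mathbb R^2),\qquad (e_nf)(r,\theta)=r^{-1/2}f(r)\,\frac{e^{in\theta}}{\sqrt{2\pi}},$$ and let $H^G_B$ be the orthogonal direct sum in $L^2(\mathbb R^2)\otimes\mathbb C^2$ of the operators $h^{1,\alpha_m}_m$ ($m\in\mathbb Z$, acting in the upper component through $e_m$) and $h^{2,\beta_{m'}}_{m'}$ ($m'\in\mathbb Z$, acting in the lower component through $e_{m'}$); $H^O_B$ is the operator with all $\alpha_n=\beta_n=0$. With $a_i=\frac12\big(|n|+n+1-\frac{k-s_iB}{B}\big)$, Kummer's function ${}_1F_1$ and Tricomi's function $U$, let $$F^{(i)}_n(k,r)=r^{1/2+|n|}e^{-Br^2/4}{}_1F_1\big(a_i;|n|+1;\tfrac B2r^2\big),\qquad G^{(i)}_n(k,r)=r^{1/2+|n|}e^{-Br^2/4}\,U\big(a_i,|n|+1,\tfrac B2r^2\big),$$ let a prime denote $\partial_r$, let $W^{(i)}_n(k)=\big(G^{(i)}_nF'^{(i)}_n-G'^{(i)}_nF^{(i)}_n\big)(k,R)$, $M^{(i)}_n(k)=1/W^{(i)}_n(k)$, and $$\phi^{i}_n(k,r)=\begin{cases}M^{(i)}_n(k)\,G'^{(i)}_n(k,R)\,F^{(i)}_n(k,r),&r<R,\\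 M^{(i)}_n(k)\,F'^{(i)}_n(k,R)\,G^{(i)}_n(k,r),&r>R.\end{cases}$$ For $m,m'\in\mathbb Z$ put $\Psi^1_{m,m'}(k)=(\phi^1_m(k),0)$ and $\Psi^2_{m,m'}(k)=(0,\phi^2_{m'}(k))$. Scalar products are antilinear in the first argument. (i) Let $m,m'\in\mathbb Z$ and $k\in\rho(H^{G}_{m,m'})\cap\rho(H^O_{m,m'})$. Then $W^{(1)}_m(k)$, $W^{(2)}_{m'}(k)$ and the brackets in the denominators below are nonzero, $\phi^1_m(k)$, $\phi^1_m(\bar k)$, $\phi^2_{m'}(k)$ and $\phi^2_{m'}(\bar k)$ are square integrable on $(0,\infty)$, and $$(H^{G}_{m,m'}-k)^{-1}=(H^O_{m,m'}-k)^{-1}+\sum_{i,j=1}^2\mu_{ij}(k)\,\big(\Psi^i_{m,m'}(\bar k),\,\cdot\,\big)\,\Psi^j_{m,m'}(k),$$ where $\mu_{12}=\mu_{21}=0$ and $$\mu_{11}(k)=\frac{\alpha_m}{M^{(1)}_m\big(G^{(1)}_mF'^{(1)}_m-G'^{(1)}_mF^{(1)}_m-\alpha_mG'^{(1)}_mF'^{(1)}_m\big)}\bigg|_{r=R},$$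 $$\mu_{22}(k)=\frac{\beta_{m'}}{M^{(2)}_{m'}\big(G^{(2)}_{m'}F'^{(2)}_{m'}-G'^{(2)}_{m'}F^{(2)}_{m'}-\beta_{m'}G'^{(2)}_{m'}F'^{(2)}_{m'}\big)}\bigg|_{r=R}.$$ Moreover $(H^O_{m,m'}-k)^{-1}$ is the integral operator with kernel $\mathrm{diag}(g^{11}(k,r,r'),g^{22}(k,r,r'))$ (the integrals converge absolutely for every $r>0$), where, with $n=m$ for $i=1$ and $n=m'$ for $i=2$, $$g^{ii}(k,r,r')=\begin{cases}M^{(i)}_n(k)\,G^{(i)}_n(k,r)\,F^{(i)}_n(k,r'),&r'\le r,\\ M^{(i)}_n(k)\,F^{(i)}_n(k,r)\,G^{(i)}_n(k,r'),&r'>r,\end{cases}$$ and $\partial_\rho g^{ii}(k,\rho,r)\big|_{\rho=R}=\phi^i_n(k,r)$ for all $r>0$, $r\ne R$. (ii) Let $k\in\rho(H^G_B)\cap\rho(H^O_B)$. Then $k\in\rho(H^G_{m,m'})\cap\rho(H^O_{m,m'})$ for all $m,m'\in\mathbb Z$. The resolvents $(H^G_B-k)^{-1}$ and $(H^O_B-k)^{-1}$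 are the direct sums of the radial resolvents: $(H^{G}_B-k)^{-1}(e_mf_1,e_{m'}f_2)=(e_mu_1,e_{m'}u_2)$ with $(u_1,u_2)=(H^G_{m,m'}-k)^{-1}(f_1,f_2)$ for all $m,m'$ and $f_1,f_2\in L^2((0,\infty))$, and likewise for $O$ in place of $G$. For all $\psi=(\psi_1,\psi_2)\in L^2(\mathbb R^2)\otimes\mathbb C^2$, $$(H^G_B-k)^{-1}\psi=(H^O_B-k)^{-1}\psi+\Big(\sum_{m\in\mathbb Z}\mu_{11}^{(m)}(k)\big(e_m\phi^1_m(\bar k),\psi_1\big)\,e_m\phi^1_m(k),\ \sum_{m'\in\mathbb Z}\mu_{22}^{(m')}(k)\big(e_{m'}\phi^2_{m'}(\bar k),\psi_2\big)\,e_{m'}\phi^2_{m'}(k)\Big),$$ with unconditional convergence in norm, where $\mu_{11}^{(m)}$ and $\mu_{22}^{(m')}$ are the coefficients of (i). -/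

import Mathlib

open MeasureTheory Set Filter Topology
open scoped ComplexConjugate InnerProductSpace

noncomputable section

namespace LandauCylinder

/-! ### Unbounded operators, their resolvents, and direct sums -/

section Operators

variable {E : Type*} [NormedAddCommGroup E] [InnerProductSpace ℂ E]

/-- `S` is a bounded everywhere defined two-sided inverse of `T - k`. -/
def IsResolventAt (T : E →ₗ.[ℂ] E) (k : ℂ) (S : E →L[ℂ] E) : Prop :=
  (∀ x : E, ∃ h : S x ∈ T.domain, T ⟨S x, h⟩ - k • S x = x) ∧
    ∀ u : T.domain, S (T u - k • (u : E)) = u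

/-- The resolvent set `ρ(T)` of an unbounded operator. -/
def opResolventSet (T : E →ₗ.[ℂ] E) : Set ℂ := {k | ∃ S : E →L[ℂ] E, IsResolventAt T k S}

open Classical in
/-- The resolvent `(T - k)⁻¹` (zero if `k` is not in the resolvent set). -/
def opResolvent (T : E →ₗ.[ℂ] E) (k : ℂ) : E →L[ℂ] E :=
  if h : ∃ S : E →L[ℂ] E, IsResolventAt T k S then h.choose else 0

/-- The diagonal operator `diag(T 0, T 1)` on `G ⊗ ℂ² = G ⊕ G`, with domain the pairs whose
`i`-th component lies in the domain of `T i`. -/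
def diagOp {G : Type*} [NormedAddCommGroup G] [InnerProductSpace ℂ G]
    (T : Fin 2 → G →ₗ.[ℂ] G) :
    PiLp 2 (fun _ : Fin 2 => G) →ₗ.[ℂ] PiLp 2 (fun _ : Fin 2 => G) where
  domain :=
    { carrier := {u | ∀ i, u i ∈ (T i).domain}
      add_mem' := fun hu hv i => (T i).domain.add_mem (hu i) (hv i)
      zero_mem' := fun i => (T i).domain.zero_mem
      smul_mem' := fun c _ hu i => (T i).domain.smul_mem c (hu i) }
  toFun :=
    { toFun := fun u => WithLp.toLp 2 fun i => T i ⟨(u : PiLp 2 (fun _ : Fin 2 => G)) i, u.2 i⟩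
      map_add' := by
        intro u v
        ext1 i
        exact (T i).map_add ⟨_, u.2 i⟩ ⟨_, v.2 i⟩
      map_smul' := by
        intro c u
        ext1 i
        exact (T i).map_smul c ⟨_, u.2 i⟩ }

variable [CompleteSpace E] {ι : Type*} {G : ι → Type*} [∀ i, NormedAddCommGroup (G i)]
  [∀ i, InnerProductSpace ℂ (G i)] {V : ∀ i, G i →ₗᵢ[ℂ] E}

/-- The graph of the orthogonal direct sum `⨁ᵢ Vᵢ Tᵢ Vᵢ⁻¹`: pairs `(∑ᵢ Vᵢ fᵢ, ∑ᵢ Vᵢ gᵢ)` with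
`(fᵢ)`, `(gᵢ)` square summable, `fᵢ ∈ D(Tᵢ)` and `gᵢ = Tᵢ fᵢ` for every `i`. -/
def directSumGraph (hV : OrthogonalFamily ℂ G V) (T : ∀ i, G i →ₗ.[ℂ] G i) :
    Submodule ℂ (E × E) where
  carrier := {p | ∃ f g : lp G 2, hV.linearIsometry f = p.1 ∧ hV.linearIsometry g = p.2 ∧
    ∀ i, (f i, g i) ∈ (T i).graph}
  add_mem' := by
    rintro p q ⟨f, g, hf, hg, h⟩ ⟨f', g', hf', hg', h'⟩
    refine ⟨f + f', g + g', by rw [map_add, hf, hf']; rfl, by rw [map_add, hg, hg']; rfl,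
      fun i => (T i).graph.add_mem (h i) (h' i)⟩
  zero_mem' := ⟨0, 0, by simp, by simp, fun i => (T i).graph.zero_mem⟩
  smul_mem' := by
    rintro c p ⟨f, g, hf, hg, h⟩
    exact ⟨c • f, c • g, by rw [map_smul, hf]; rfl, by rw [map_smul, hg]; rfl,
      fun i => (T i).graph.smul_mem c (h i)⟩

/-- The graph above is the graph of an operator. -/
theorem directSumGraph_isGraph (hV : OrthogonalFamily ℂ G V) (T : ∀ i, G i →ₗ.[ℂ] G i)
    (p : E × E) (hp : p ∈ directSumGraph hV T) (h0 : p.1 = 0) : p.2 = 0 := by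
  obtain ⟨f, g, hf, hg, h⟩ := hp
  have hf0 : f = 0 := by
    apply hV.linearIsometry.injective
    rw [hf, h0, map_zero]
  subst hf0
  have hg0 : g = 0 := by
    ext1
    funext i
    exact (T i).graph_fst_eq_zero_snd (h i) rfl
  rw [← hg, hg0, map_zero]

/-- The orthogonal direct sum of the operators `Tᵢ`, acting in `E` through the mutually
orthogonal isometric embeddings `Vᵢ : Gᵢ → E`. -/
def directSumOp (hV : OrthogonalFamily ℂ G V) (T : ∀ i, G i →ₗ.[ℂ] G i) : E →ₗ.[ℂ] E :=
  (directSumGraph hV T).toLinearPMap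

theorem directSumOp_graph (hV : OrthogonalFamily ℂ G V) (T : ∀ i, G i →ₗ.[ℂ] G i) :
    (directSumOp hV T).graph = directSumGraph hV T :=
  Submodule.toLinearPMap_graph_eq _ (directSumGraph_isGraph hV T)

end Operators

/-! ### Hilbert spaces -/

/-- `L²((0,∞), dr)`. -/
abbrev RadialL2 : Type := Lp ℂ 2 (volume.restrict (Ioi (0 : ℝ)))

/-- `L²((0,∞), dr) ⊗ ℂ²`. -/
abbrev RadialSpinor : Type := PiLp 2 (fun _ : Fin 2 => RadialL2)

/-- `L²(ℝ²)`. -/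
abbrev PlaneL2 : Type := Lp ℂ 2 (volume : Measure (ℝ × ℝ))

/-- `L²(ℝ²) ⊗ ℂ²`. -/
abbrev PlaneSpinor : Type := PiLp 2 (fun _ : Fin 2 => PlaneL2)

open Classical in
/-- The class in `L²((0,∞), dr)` of a square integrable function (zero otherwise). -/
def toRadialL2 (f : ℝ → ℂ) : RadialL2 :=
  if h : MemLp f 2 (volume.restrict (Ioi (0 : ℝ))) then h.toLp f else 0

/-! ### The radial operators with `δ'`-conditions on the circle of radius `R` -/

/-- The sign of the spin component: `+1` for the upper, `-1` for the lower component. -/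
def spin : Fin 2 → ℝ := ![1, -1]

/-- The potential `(n/r + B r/2)² - 1/(4r²) ± B` of the radial operator. -/
def potential (B : ℝ) (i : Fin 2) (n : ℤ) (r : ℝ) : ℝ :=
  (n / r + B / 2 * r) ^ 2 - 1 / (4 * r ^ 2) + spin i * B

/-- `f ∈ H²_loc((0,∞) ∖ {R})`, with `f'` its derivative (locally absolutely continuous) and
`f''` its second weak derivative (locally square integrable). -/
structure IsH2Loc (R : ℝ) (f f' f'' : ℝ → ℂ) : Prop where
  hasDerivAt : ∀ r, 0 < r → r ≠ R → HasDerivAt f (f' r) r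
  memLp : ∀ a b, 0 < a → a ≤ b → R ∉ Icc a b → MemLp f'' 2 (volume.restrict (Icc a b))
  integral_eq : ∀ a b, 0 < a → a ≤ b → R ∉ Icc a b → f' b - f' a = ∫ r in a..b, f'' r

/-- The `δ'`-condition at `R`: `f'(R₊) = f'(R₋) = f'(R)` and `f(R₊) - f(R₋) = γ f'(R)`. -/
def DeltaPrimeCondition (R γ : ℝ) (f f' : ℝ → ℂ) : Prop :=
  ∃ fp fm d : ℂ, Tendsto f (𝓝[>] R) (𝓝 fp) ∧ Tendsto f (𝓝[<] R) (𝓝 fm) ∧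
    Tendsto f' (𝓝[>] R) (𝓝 d) ∧ Tendsto f' (𝓝[<] R) (𝓝 d) ∧ fp - fm = γ * d

/-- The regularity condition at the origin. It is needed only for angular momentum `0`, where
the radial expression is in the limit circle case at `0`; it selects the functions that are
regular at the origin of the plane. -/
def OriginCondition (n : ℤ) (f : ℝ → ℂ) : Prop :=
  n = 0 → Tendsto (fun r : ℝ => f r / ((√r * Real.log r : ℝ) : ℂ)) (𝓝[>] 0) (𝓝 0)

theorem IsH2Loc.add {R : ℝ} {f f' f'' g g' g'' : ℝ → ℂ} (hf : IsH2Loc R f f' f'')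
    (hg : IsH2Loc R g g' g'') : IsH2Loc R (f + g) (f' + g') (f'' + g'') where
  hasDerivAt r h0 hR := (hf.hasDerivAt r h0 hR).add (hg.hasDerivAt r h0 hR)
  memLp a b h0 hab hR := (hf.memLp a b h0 hab hR).add (hg.memLp a b h0 hab hR)
  integral_eq a b h0 hab hR := by
    have hI : ∀ {w : ℝ → ℂ}, MemLp w 2 (volume.restrict (Icc a b)) →
        IntervalIntegrable w volume a b := by
      intro w hw
      rw [intervalIntegrable_iff_integrableOn_Icc_of_le hab]
      exact hw.integrable (by norm_num)
    have h1 := hf.integral_eq a b h0 hab hR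
    have h2 := hg.integral_eq a b h0 hab hR
    simp only [Pi.add_apply]
    rw [intervalIntegral.integral_add (hI (hf.memLp a b h0 hab hR))
      (hI (hg.memLp a b h0 hab hR)), ← h1, ← h2]
    ring

theorem IsH2Loc.smul {R : ℝ} {f f' f'' : ℝ → ℂ} (c : ℂ) (hf : IsH2Loc R f f' f'') :
    IsH2Loc R (c • f) (c • f') (c • f'') where
  hasDerivAt r h0 hR := (hf.hasDerivAt r h0 hR).const_smul c
  memLp a b h0 hab hR := (hf.memLp a b h0 hab hR).const_smul c
  integral_eq a b h0 hab hR := by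
    have h1 := hf.integral_eq a b h0 hab hR
    simp only [Pi.smul_apply, smul_eq_mul]
    rw [intervalIntegral.integral_const_mul, ← h1]
    ring

/-- The graph of the radial operator: pairs `(u, v)` in `L²((0,∞))` such that `u` has a
representative `f ∈ H²_loc((0,∞) ∖ {R})` which satisfies the boundary conditions, and
`v = -f'' + potential * f`. -/
def radialGraph (B R : ℝ) (i : Fin 2) (n : ℤ) (γ : ℝ) : Submodule ℂ (RadialL2 × RadialL2) where
  carrier := {p | ∃ f f' f'' : ℝ → ℂ, p.1 =ᵐ[volume.restrict (Ioi (0 : ℝ))] f ∧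
    IsH2Loc R f f' f'' ∧ DeltaPrimeCondition R γ f f' ∧ OriginCondition n f ∧
    p.2 =ᵐ[volume.restrict (Ioi (0 : ℝ))] fun r => -f'' r + (potential B i n r : ℂ) * f r}
  add_mem' := by
    rintro ⟨u, v⟩ ⟨u', v'⟩ ⟨f, f', f'', hu, hf, ⟨fp, fm, d, h1, h2, h3, h4, h5⟩, ho, hv⟩
      ⟨g, g', g'', hu', hg, ⟨gp, gm, e, k1, k2, k3, k4, k5⟩, ho', hv'⟩
    refine ⟨f + g, f' + g', f'' + g'', ?_, hf.add hg,
      ⟨fp + gp, fm + gm, d + e, h1.add k1, h2.add k2, h3.add k3, h4.add k4, ?_⟩, ?_, ?_⟩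
    · exact (Lp.coeFn_add u u').trans (hu.add hu')
    · linear_combination h5 + k5
    · intro h0
      have := (ho h0).add (ho' h0)
      rw [add_zero] at this
      refine this.congr fun r => ?_
      simp only [Pi.add_apply, add_div]
    · filter_upwards [Lp.coeFn_add v v', hv, hv'] with r a b c
      simp only [Prod.snd_add, Pi.add_apply] at a b c ⊢
      rw [a, b, c]
      ring
  zero_mem' := by
    refine ⟨0, 0, 0, Lp.coeFn_zero _ _ _, ⟨fun r _ _ => hasDerivAt_const r 0, fun _ _ _ _ _ =>
      MemLp.zero, fun _ _ _ _ _ => by simp⟩, ⟨0, 0, 0, ?_, ?_, ?_, ?_, by simp⟩, ?_, ?_⟩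
    · exact tendsto_const_nhds
    · exact tendsto_const_nhds
    · exact tendsto_const_nhds
    · exact tendsto_const_nhds
    · intro _
      simp
    · filter_upwards [Lp.coeFn_zero ℂ 2 (volume.restrict (Ioi (0 : ℝ)))] with r a
      simpa using a
  smul_mem' := by
    rintro c ⟨u, v⟩ ⟨f, f', f'', hu, hf, ⟨fp, fm, d, h1, h2, h3, h4, h5⟩, ho, hv⟩
    refine ⟨c • f, c • f', c • f'', ?_, hf.smul c,
      ⟨c • fp, c • fm, c • d, h1.const_smul c, h2.const_smul c, h3.const_smul c,
        h4.const_smul c, ?_⟩, ?_, ?_⟩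
    · exact (Lp.coeFn_smul c u).trans (hu.const_smul c)
    · simp only [smul_eq_mul]
      linear_combination c * h5
    · intro h0
      have := (ho h0).const_smul c
      rw [smul_zero] at this
      refine this.congr fun r => ?_
      simp only [Pi.smul_apply, smul_eq_mul, mul_div_assoc]
    · filter_upwards [Lp.coeFn_smul c v, hv] with r a b
      simp only [Prod.smul_snd, Pi.smul_apply, smul_eq_mul] at a b ⊢
      rw [a, b]
      ring

/-- The graph above is the graph of an operator. -/
theorem radialGraph_isGraph (B R : ℝ) (i : Fin 2) (n : ℤ) (γ : ℝ) (p : RadialL2 × RadialL2)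
    (hp : p ∈ radialGraph B R i n γ) (h0 : p.1 = 0) : p.2 = 0 := by
  obtain ⟨f, f', f'', hu, hf, -, -, hv⟩ := hp
  rw [h0] at hu
  have hU : IsOpen (Ioi (0 : ℝ) \ {R}) := isOpen_Ioi.sdiff isClosed_singleton
  have hf0 : f =ᵐ[volume.restrict (Ioi (0 : ℝ))] 0 := hu.symm.trans (Lp.coeFn_zero _ _ _)
  have hfU : EqOn f 0 (Ioi (0 : ℝ) \ {R}) := by
    refine Measure.eqOn_open_of_ae_eq
      (hf0.filter_mono (ae_mono (Measure.restrict_mono sdiff_subset le_rfl))) hU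
      (fun r hr => (hf.hasDerivAt r hr.1 hr.2).continuousAt.continuousWithinAt)
      continuousOn_const
  have hf'U : ∀ r ∈ Ioi (0 : ℝ) \ {R}, f' r = 0 := by
    intro r hr
    have h1 : f =ᶠ[𝓝 r] fun _ => (0 : ℂ) := by
      filter_upwards [hU.mem_nhds hr] with x hx using hfU hx
    exact (hf.hasDerivAt r hr.1 hr.2).unique ((hasDerivAt_const r (0 : ℂ)).congr_of_eventuallyEq h1)
  have hkey : ∀ᵐ x : ℝ, ∀ a b : ℚ, (0 : ℝ) < a → (a : ℝ) < x → x < (b : ℝ) →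
      R ∉ Icc (a : ℝ) b → f'' x = 0 := by
    rw [ae_all_iff]
    intro a
    rw [ae_all_iff]
    intro b
    by_cases hab : 0 < (a : ℝ) ∧ (a : ℝ) ≤ b ∧ R ∉ Icc (a : ℝ) b
    · obtain ⟨ha, hab, hR⟩ := hab
      have hI : IntervalIntegrable f'' volume a b := by
        rw [intervalIntegrable_iff_integrableOn_Icc_of_le hab]
        exact (hf.memLp a b ha hab hR).integrable (by norm_num)
      filter_upwards [hI.ae_hasDerivAt_integral] with x hx _ hax hxb _
      rw [uIcc_of_le hab] at hx
      have h1 := hx ⟨hax.le, hxb.le⟩ a ⟨le_rfl, hab⟩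
      have h2 : (fun x => ∫ t in (a : ℝ)..x, f'' t) =ᶠ[𝓝 x] fun _ => (0 : ℂ) := by
        filter_upwards [Ioo_mem_nhds hax hxb] with y hy
        have hRy : R ∉ Icc (a : ℝ) y := fun h => hR ⟨h.1, h.2.trans hy.2.le⟩
        rw [← hf.integral_eq a y ha hy.1.le hRy,
          hf'U y ⟨ha.trans hy.1, fun h => hRy ⟨h ▸ hy.1.le, h ▸ le_rfl⟩⟩,
          hf'U a ⟨ha, fun h => hRy ⟨h ▸ le_rfl, h ▸ hy.1.le⟩⟩, sub_zero]
      exact h1.unique ((hasDerivAt_const x (0 : ℂ)).congr_of_eventuallyEq h2)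
    · filter_upwards with x ha hax hxb hR
      exact absurd ⟨ha, (hax.trans hxb).le, hR⟩ hab
  have hf'' : ∀ᵐ x ∂(volume.restrict (Ioi (0 : ℝ))), f'' x = 0 := by
    have hne : ∀ᵐ x : ℝ, x ≠ R := by simp [ae_iff, measure_singleton]
    filter_upwards [ae_restrict_of_ae hkey, ae_restrict_of_ae hne,
      ae_restrict_mem measurableSet_Ioi] with x hx hxR hx0
    rcases lt_or_gt_of_ne hxR with h | h
    · obtain ⟨a, ha0, hax⟩ := exists_rat_btwn (show (0 : ℝ) < x from hx0)
      obtain ⟨b, hxb, hbR⟩ := exists_rat_btwn h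
      exact hx a b ha0 hax hxb fun hh => absurd hh.2 (not_le.2 hbR)
    · obtain ⟨a, ha0, hax⟩ := exists_rat_btwn (show max 0 R < x from max_lt hx0 h)
      obtain ⟨b, hxb, -⟩ := exists_rat_btwn (lt_add_one x)
      exact hx a b ((le_max_left _ _).trans_lt ha0) hax hxb fun hh =>
        absurd hh.1 (not_le.2 ((le_max_right _ _).trans_lt ha0))
  rw [Lp.eq_zero_iff_ae_eq_zero]
  filter_upwards [hv, hf0, hf''] with r h1 h2 h3
  rw [h1, h2, h3]
  simp

/-- The radial operator `-d²/dr² + (n/r + B r/2)² - 1/(4r²) ± B` in `L²((0,∞))` with the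
`δ'`-condition of strength `γ` at `R`. -/
def radialOp (B R : ℝ) (i : Fin 2) (n : ℤ) (γ : ℝ) : RadialL2 →ₗ.[ℂ] RadialL2 :=
  (radialGraph B R i n γ).toLinearPMap

theorem radialOp_graph (B R : ℝ) (i : Fin 2) (n : ℤ) (γ : ℝ) :
    (radialOp B R i n γ).graph = radialGraph B R i n γ :=
  Submodule.toLinearPMap_graph_eq _ (radialGraph_isGraph B R i n γ)

/-- The operator `diag(h¹, h²)` in `L²((0,∞)) ⊗ ℂ²` with angular momenta `ℓ = (m, m')` and
coupling matrix `diag(γ 0, γ 1)`. -/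
def spinorRadialOp (B R : ℝ) (ℓ : Fin 2 → ℤ) (γ : Fin 2 → ℝ) : RadialSpinor →ₗ.[ℂ] RadialSpinor :=
  diagOp fun i => radialOp B R i (ℓ i) (γ i)

/-! ### The embeddings `f ↦ r^{-1/2} f(r) e^{inθ} / √(2π)` and the operator in the plane -/

/-- The function `r^{-1/2} f(r) e^{inθ} / √(2π)` on the plane, in polar coordinates. -/
def angularFun (n : ℤ) (f : ℝ → ℂ) (p : ℝ × ℝ) : ℂ :=
  f (polarCoord p).1 / (√(polarCoord p).1 : ℂ) *
    (Complex.exp (n * (polarCoord p).2 * Complex.I) / (√(2 * Real.pi) : ℂ))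

theorem measurable_polarCoord_fst : Measurable fun p : ℝ × ℝ => (polarCoord p).1 := by
  simp only [polarCoord_apply]
  fun_prop

theorem measurable_polarCoord_snd : Measurable fun p : ℝ × ℝ => (polarCoord p).2 := by
  simp only [polarCoord_apply]
  exact Complex.measurable_arg.comp (Complex.measurableEquivRealProd.symm.measurable)

theorem lintegral_radial {h : ℝ → ENNReal} (hh : Measurable h) :
    ∫⁻ p : ℝ × ℝ, h (polarCoord p).1 =
      (∫⁻ r in Ioi (0 : ℝ), ENNReal.ofReal r * h r) * ENNReal.ofReal (2 * Real.pi) := by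
  rw [← lintegral_comp_polarCoord_symm]
  have h1 : ∫⁻ p in polarCoord.target, ENNReal.ofReal p.1 • h (polarCoord (polarCoord.symm p)).1
      = ∫⁻ p in polarCoord.target, (ENNReal.ofReal p.1 * h p.1) * 1 := by
    refine setLIntegral_congr_fun polarCoord.open_target.measurableSet fun p hp => ?_
    simp only [polarCoord.right_inv hp, smul_eq_mul, mul_one]
  rw [h1, polarCoord_target, Measure.volume_eq_prod, ← Measure.prod_restrict,
    lintegral_prod_mul (f := fun r : ℝ => ENNReal.ofReal r * h r) (g := fun _ => 1)
      (by fun_prop) (by fun_prop)]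
  congr 1
  rw [lintegral_one, Measure.restrict_apply_univ, Real.volume_Ioo]
  ring_nf

theorem ae_radial {P : ℝ → Prop} (h : ∀ᵐ r ∂(volume.restrict (Ioi (0 : ℝ))), P r) :
    ∀ᵐ p : ℝ × ℝ, P (polarCoord p).1 := by
  obtain ⟨t, ht, htm, ht0⟩ := exists_measurable_superset_of_null (ae_iff.1 h)
  have h2 : ∫⁻ p : ℝ × ℝ, t.indicator 1 (polarCoord p).1 = 0 := by
    rw [lintegral_radial (measurable_one.indicator htm)]
    have : ∫⁻ r in Ioi (0 : ℝ), ENNReal.ofReal r * t.indicator 1 r = 0 := by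
      rw [lintegral_eq_zero_iff (by
        exact ENNReal.measurable_ofReal.mul (measurable_one.indicator htm))]
      have h3 : ∀ᵐ r ∂(volume.restrict (Ioi (0 : ℝ))), r ∉ t := by
        rw [ae_iff]
        simpa using ht0
      filter_upwards [h3] with r hr
      simp [hr]
    rw [this, zero_mul]
  rw [lintegral_eq_zero_iff (by
    exact (measurable_one.indicator htm).comp measurable_polarCoord_fst)] at h2
  filter_upwards [h2] with p hp
  by_contra hc
  have h4 : t.indicator (1 : ℝ → ENNReal) (polarCoord p).1 = 1 := indicator_of_mem (ht hc) _
  have h5 : t.indicator (1 : ℝ → ENNReal) (polarCoord p).1 = 0 := hp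
  exact one_ne_zero (h4.symm.trans h5)

theorem enorm_angularFun (n : ℤ) (f : ℝ → ℂ) (p : ℝ × ℝ) :
    ‖angularFun n f p‖ₑ =
      ‖f (polarCoord p).1 / (√(polarCoord p).1 : ℂ) / (√(2 * Real.pi) : ℂ)‖ₑ := by
  have h1 : ‖Complex.exp (n * (polarCoord p).2 * Complex.I)‖ₑ = 1 := by
    have h2 : (n : ℂ) * (polarCoord p).2 * Complex.I
        = ((n * (polarCoord p).2 : ℝ) : ℂ) * Complex.I := by push_cast; ring
    rw [h2, ← ofReal_norm, Complex.norm_exp_ofReal_mul_I, ENNReal.ofReal_one]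
  rw [angularFun, mul_div_left_comm, enorm_mul, h1, one_mul]

theorem memLp_angularFun (n : ℤ) (u : RadialL2) : MemLp (angularFun n u) 2 volume := by
  have hu : Measurable (u : ℝ → ℂ) := (Lp.stronglyMeasurable u).measurable
  have hf := measurable_polarCoord_fst
  have hs := measurable_polarCoord_snd
  have hm : Measurable (angularFun n u) := by
    unfold angularFun
    exact ((hu.comp hf).div (Complex.measurable_ofReal.comp hf.sqrt)).mul
      ((Complex.measurable_exp.comp
        (((Complex.measurable_ofReal.comp hs).const_mul _).mul_const _)).div_const _)
  refine ⟨hm.aestronglyMeasurable, ?_⟩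
  rw [eLpNorm_lt_top_iff_lintegral_rpow_enorm_lt_top two_ne_zero ENNReal.ofNat_ne_top]
  simp only [enorm_angularFun, ENNReal.toReal_ofNat]
  have hh : Measurable fun r : ℝ => ‖u r / (√r : ℂ) / (√(2 * Real.pi) : ℂ)‖ₑ ^ (2 : ℝ) := by
    fun_prop
  rw [lintegral_radial hh]
  refine ENNReal.mul_lt_top ?_ ENNReal.ofReal_lt_top
  have h2 := (eLpNorm_lt_top_iff_lintegral_rpow_enorm_lt_top two_ne_zero
    ENNReal.ofNat_ne_top).1 (Lp.memLp u).2
  refine lt_of_le_of_lt (setLIntegral_mono (by fun_prop) fun r hr => ?_) h2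
  have hr' : (0 : ℝ) < r := hr
  rw [ENNReal.toReal_ofNat, ENNReal.rpow_ofNat, ENNReal.rpow_ofNat, ← ofReal_norm,
    ← ofReal_norm, ← ENNReal.ofReal_pow (norm_nonneg _),
    ← ENNReal.ofReal_pow (norm_nonneg _), ← ENNReal.ofReal_mul hr'.le]
  refine ENNReal.ofReal_le_ofReal ?_
  have hpi : (1 : ℝ) ≤ 2 * Real.pi := by linarith [Real.pi_gt_three]
  rw [norm_div, norm_div, Complex.norm_real, Complex.norm_real, Real.norm_eq_abs,
    Real.norm_eq_abs, div_pow, div_pow, sq_abs, sq_abs, Real.sq_sqrt hr'.le,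
    Real.sq_sqrt (by positivity)]
  have h3 : r * (‖u r‖ ^ 2 / r / (2 * Real.pi)) = ‖u r‖ ^ 2 / (2 * Real.pi) := by
    field_simp
  rw [h3]
  exact div_le_self (by positivity) hpi

theorem integral_angular (j : ℤ) :
    ∫ θ in Ioo (-Real.pi) Real.pi, Complex.exp (j * θ * Complex.I) / (2 * Real.pi : ℂ) =
      if j = 0 then 1 else 0 := by
  have hpi : (Real.pi : ℂ) ≠ 0 := by exact_mod_cast Real.pi_ne_zero
  have hle : -Real.pi ≤ Real.pi := by linarith [Real.pi_pos]
  rw [← integral_Ioc_eq_integral_Ioo, ← intervalIntegral.integral_of_le hle,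
    intervalIntegral.integral_div]
  split_ifs with h
  · subst h
    simp
    field_simp
    ring
  · have hj : (j : ℂ) * Complex.I ≠ 0 := by simp [h]
    have h1 : ∀ θ : ℝ, (j : ℂ) * θ * Complex.I = j * Complex.I * θ := fun θ => by ring
    simp only [h1]
    rw [integral_exp_mul_complex hj]
    have h2 : Complex.exp (j * Complex.I * (Real.pi : ℝ))
        = Complex.exp (j * Complex.I * ((-Real.pi : ℝ) : ℂ)) := by
      rw [Complex.exp_eq_exp_iff_exists_int]
      exact ⟨j, by push_cast; ring⟩
    rw [h2, sub_self, zero_div, zero_div]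

theorem inner_angularFun (m n : ℤ) (u v : RadialL2) :
    ⟪(memLp_angularFun m u).toLp, (memLp_angularFun n v).toLp⟫_ℂ =
      if m = n then ⟪u, v⟫_ℂ else 0 := by
  have hpi : (0 : ℝ) ≤ 2 * Real.pi := by positivity
  rw [L2.inner_def, L2.inner_def]
  have h1 : ∫ p, ⟪((memLp_angularFun m u).toLp : ℝ × ℝ → ℂ) p,
        ((memLp_angularFun n v).toLp : ℝ × ℝ → ℂ) p⟫_ℂ
      = ∫ p, ⟪angularFun m u p, angularFun n v p⟫_ℂ := by
    refine integral_congr_ae ?_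
    filter_upwards [(memLp_angularFun m u).coeFn_toLp, (memLp_angularFun n v).coeFn_toLp]
      with p h h'
    rw [h, h']
  rw [h1, ← integral_comp_polarCoord_symm]
  have h2 : ∫ p in polarCoord.target, p.1 • ⟪angularFun m u (polarCoord.symm p),
        angularFun n v (polarCoord.symm p)⟫_ℂ
      = ∫ p in polarCoord.target, ⟪u p.1, v p.1⟫_ℂ *
        (Complex.exp (((n - m : ℤ) : ℂ) * p.2 * Complex.I) / (2 * Real.pi : ℂ)) := by
    refine setIntegral_congr_fun polarCoord.open_target.measurableSet fun p hp => ?_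
    have hr : 0 < p.1 := hp.1
    have hr' : (√p.1 : ℂ) * (√p.1 : ℂ) = p.1 := by
      exact_mod_cast Real.mul_self_sqrt hr.le
    have hp' : (√(2 * Real.pi) : ℂ) * (√(2 * Real.pi) : ℂ) = 2 * Real.pi := by
      exact_mod_cast Real.mul_self_sqrt hpi
    have hp0 : (p.1 : ℂ) ≠ 0 := by exact_mod_cast hr.ne'
    have he : Complex.exp (((n - m : ℤ) : ℂ) * p.2 * Complex.I)
        = Complex.exp (n * p.2 * Complex.I) * Complex.exp (-(m * p.2 * Complex.I)) := by
      rw [← Complex.exp_add]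
      congr 1
      push_cast
      ring
    simp only [angularFun, polarCoord.right_inv hp, RCLike.inner_apply, map_mul, map_div₀,
      Complex.conj_ofReal, ← Complex.exp_conj, Complex.conj_I, map_intCast, Complex.real_smul]
    rw [he, ← hp', mul_neg]
    nth_rewrite 1 [← hr']
    have hs0 : (√p.1 : ℂ) ≠ 0 := fun h => hp0 (by rw [← hr', h, zero_mul])
    field_simp
  rw [h2, polarCoord_target, Measure.volume_eq_prod,
    setIntegral_prod_mul (fun r : ℝ => ⟪u r, v r⟫_ℂ)
      (fun θ : ℝ => Complex.exp (((n - m : ℤ) : ℂ) * θ * Complex.I) / (2 * Real.pi : ℂ)),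
    integral_angular]
  by_cases h : m = n
  · rw [if_pos h, if_pos (by rw [h, sub_self]), mul_one]
  · rw [if_neg h, if_neg (fun h' => h (sub_eq_zero.1 h').symm), mul_zero]

/-- The isometric embedding `L²((0,∞), dr) → L²(ℝ²)`, `f ↦ r^{-1/2} f(r) e^{inθ} / √(2π)`. -/
def angularEmbedding (n : ℤ) : RadialL2 →ₗᵢ[ℂ] PlaneL2 where
  toFun u := (memLp_angularFun n u).toLp
  map_add' u v := by
    rw [← MemLp.toLp_add, MemLp.toLp_eq_toLp_iff]
    filter_upwards [ae_radial (Lp.coeFn_add u v)] with p hp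
    simp only [angularFun, Pi.add_apply] at hp ⊢
    rw [hp]
    ring
  map_smul' c u := by
    rw [RingHom.id_apply, ← MemLp.toLp_const_smul, MemLp.toLp_eq_toLp_iff]
    filter_upwards [ae_radial (Lp.coeFn_smul c u)] with p hp
    simp only [angularFun, Pi.smul_apply, smul_eq_mul] at hp ⊢
    rw [hp]
    ring
  norm_map' u := by
    change ‖(memLp_angularFun n u).toLp‖ = _
    rw [@norm_eq_sqrt_re_inner ℂ, inner_angularFun, if_pos rfl, ← @norm_eq_sqrt_re_inner ℂ]

/-- The embedding of `L²((0,∞), dr)` as the spin component `p.1` with angular momentum `p.2`. -/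
def modeEmbedding (p : Fin 2 × ℤ) : RadialL2 →ₗᵢ[ℂ] PlaneSpinor where
  toFun u := PiLp.single (β := fun _ : Fin 2 => PlaneL2) 2 p.1 (angularEmbedding p.2 u)
  map_add' u v := by rw [map_add, PiLp.single_add]
  map_smul' c u := by
    rw [map_smul, RingHom.id_apply]
    ext1 j
    by_cases h : j = p.1
    · subst h
      simp
    · simp [h]
  norm_map' u := by
    change ‖PiLp.single (β := fun _ : Fin 2 => PlaneL2) 2 p.1 (angularEmbedding p.2 u)‖ = _
    rw [PiLp.norm_single, LinearIsometry.norm_map]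

theorem modeEmbedding_orthogonal :
    OrthogonalFamily ℂ (fun _ : Fin 2 × ℤ => RadialL2) modeEmbedding := by
  rintro ⟨i, m⟩ ⟨j, n⟩ hne u v
  change ⟪PiLp.single (β := fun _ : Fin 2 => PlaneL2) 2 i (angularEmbedding m u),
    PiLp.single (β := fun _ : Fin 2 => PlaneL2) 2 j (angularEmbedding n v)⟫_ℂ = 0
  rw [PiLp.inner_apply]
  refine Finset.sum_eq_zero fun l _ => ?_
  by_cases hi : l = i
  · by_cases hj : l = j
    · subst hi hj
      have hmn : m ≠ n := fun h => hne (by rw [h])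
      rw [PiLp.single_eq_same, PiLp.single_eq_same]
      exact (inner_angularFun m n u v).trans (if_neg hmn)
    · rw [PiLp.single_eq_of_ne 2 hj, inner_zero_right]
  · rw [PiLp.single_eq_of_ne 2 hi, inner_zero_left]

/-- The embedding of `L²((0,∞), dr) ⊗ ℂ²` into `L²(ℝ²) ⊗ ℂ²` with angular momenta `ℓ = (m, m')`. -/
def spinorEmbedding (ℓ : Fin 2 → ℤ) (f : RadialSpinor) : PlaneSpinor :=
  ∑ i, modeEmbedding (i, ℓ i) (f i)

/-- The operator `H_B^G` in `L²(ℝ²) ⊗ ℂ²`: the orthogonal direct sum of all radial operators. The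
coupling constant is `γ 0 m` in the upper component with angular momentum `m` and `γ 1 m'` in the
lower component with angular momentum `m'`. -/
def planeOp (B R : ℝ) (γ : Fin 2 → ℤ → ℝ) : PlaneSpinor →ₗ.[ℂ] PlaneSpinor :=
  directSumOp modeEmbedding_orthogonal fun p => radialOp B R p.1 p.2 (γ p.1 p.2)

/-! ### Confluent hypergeometric functions -/

/-- Kummer's function `₁F₁(a; b; z)`. -/
def kummerM (a b z : ℂ) : ℂ := Complex.Gamma b * Complex.regularizedHGFun {a} {b} z

/-- Tricomi's function `U(a, b, x)` for `x > 0`. For `Re a > 0` one has `N = 0`, and this is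
`Γ(a)⁻¹ ∫₀^∞ t^(a-1) e^(-xt) (1+t)^(b-a-1) dt`. In general it is the analytic continuation in `a`
of that integral, obtained by `N` integrations by parts, where `Re a + N > 0`. -/
def tricomiU (a b : ℂ) (x : ℝ) : ℂ :=
  let N : ℕ := (⌊-a.re⌋ + 1).toNat
  (-1) ^ N / Complex.Gamma (a + N) * ∫ t in Ioi (0 : ℝ), (t : ℂ) ^ (a + N - 1) *
    iteratedDeriv N (fun s : ℝ => Complex.exp (-(x * s)) * ((1 + s : ℝ) : ℂ) ^ (b - a - 1)) t

/-! ### The functions entering the resolvent -/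

/-- The first parameter `(|n| + n + 1 - (k ∓ B)/B) / 2`. -/
def kummerParam (B : ℝ) (i : Fin 2) (n : ℤ) (k : ℂ) : ℂ :=
  (|(n : ℝ)| + n + 1 - (k - spin i * B) / B) / 2

/-- `r^(1/2+|n|) e^(-B r²/4)`. -/
def radialWeight (B : ℝ) (n : ℤ) (r : ℝ) : ℂ :=
  (r ^ (1 / 2 + |(n : ℝ)|) * Real.exp (-(B * r ^ 2 / 4)) : ℝ)

/-- The solution `F` regular at the origin. -/
def solF (B : ℝ) (i : Fin 2) (n : ℤ) (k : ℂ) (r : ℝ) : ℂ :=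
  radialWeight B n r * kummerM (kummerParam B i n k) (|(n : ℝ)| + 1 : ℝ) (B / 2 * r ^ 2 : ℝ)

/-- The solution `G` square integrable at infinity. -/
def solG (B : ℝ) (i : Fin 2) (n : ℤ) (k : ℂ) (r : ℝ) : ℂ :=
  radialWeight B n r * tricomiU (kummerParam B i n k) (|(n : ℝ)| + 1 : ℝ) (B / 2 * r ^ 2)

/-- The Wronskian `G F' - G' F` at `R`. -/
def wronskian (B R : ℝ) (i : Fin 2) (n : ℤ) (k : ℂ) : ℂ :=
  solG B i n k R * deriv (solF B i n k) R - deriv (solG B i n k) R * solF B i n k R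

/-- The normalization constant `M = 1 / (G F' - G' F)(R)`. -/
def normM (B R : ℝ) (i : Fin 2) (n : ℤ) (k : ℂ) : ℂ := (wronskian B R i n k)⁻¹

/-- `φ(k, r) = M G'(k, R) F(k, r)` for `r < R` and `M F'(k, R) G(k, r)` for `r > R`. -/
def phi (B R : ℝ) (i : Fin 2) (n : ℤ) (k : ℂ) (r : ℝ) : ℂ :=
  if r < R then normM B R i n k * deriv (solG B i n k) R * solF B i n k r
  else normM B R i n k * deriv (solF B i n k) R * solG B i n k r

/-- The Green function `M G(k, r) F(k, r')` for `r' ≤ r` and `M F(k, r) G(k, r')` for `r' > r`. -/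
def green (B R : ℝ) (i : Fin 2) (n : ℤ) (k : ℂ) (r r' : ℝ) : ℂ :=
  if r' ≤ r then normM B R i n k * solG B i n k r * solF B i n k r'
  else normM B R i n k * solF B i n k r * solG B i n k r'

/-- The matrix Green function, diagonal in the spin components. -/
def greenMatrix (B R : ℝ) (ℓ : Fin 2 → ℤ) (k : ℂ) (r r' : ℝ) : Matrix (Fin 2) (Fin 2) ℂ :=
  Matrix.diagonal fun i => green B R i (ℓ i) k r r'

/-- The denominator `G F' - G' F - γ G' F'` at `R`. -/
def kreinDenom (B R : ℝ) (i : Fin 2) (n : ℤ) (γ : ℝ) (k : ℂ) : ℂ :=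
  solG B i n k R * deriv (solF B i n k) R - deriv (solG B i n k) R * solF B i n k R
    - γ * deriv (solG B i n k) R * deriv (solF B i n k) R

/-- The diagonal coefficient `γ / (M (G F' - G' F - γ G' F'))`. -/
def kreinCoeff (B R : ℝ) (i : Fin 2) (n : ℤ) (γ : ℝ) (k : ℂ) : ℂ :=
  γ / (normM B R i n k * kreinDenom B R i n γ k)

/-- The matrix `μ(k)`. -/
def kreinMatrix (B R : ℝ) (ℓ : Fin 2 → ℤ) (γ : Fin 2 → ℝ) (k : ℂ) : Matrix (Fin 2) (Fin 2) ℂ :=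
  !![kreinCoeff B R 0 (ℓ 0) (γ 0) k, 0; 0, kreinCoeff B R 1 (ℓ 1) (γ 1) k]

/-- The vectors `Ψ¹(k) = (φ¹(k), 0)` and `Ψ²(k) = (0, φ²(k))`. -/
def Psi (B R : ℝ) (ℓ : Fin 2 → ℤ) (i : Fin 2) (k : ℂ) : RadialSpinor :=
  PiLp.single 2 i (toRadialL2 (phi B R i (ℓ i) k))

end LandauCylinder

end

open LandauCylinder

namespace LandauCylinder

noncomputable section

/-! ### Resolvents through graphs: components, compressions and direct sums -/

section AbstractResolvents

variable {E : Type*} [NormedAddCommGroup E] [InnerProductSpace ℂ E]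

/-! Everything rests on explicit solutions. `F` and `G` solve the homogeneous radial equation `u'' =
(V - k) u` on the whole half-line; `F` is square integrable at `0` and satisfies the origin
condition, `G` decays at infinity.

If `k` lies in the resolvent set, then `k` is not an eigenvalue. The function equal to `c F` left of
`R` and `d G` right of `R` lies in the domain exactly when `(c, d)` solves a 2×2 linear system whose
determinant is, up to sign, `G F' - G' F - γ G' F'`. A zero of this bracket would produce an
eigenfunction, so the bracket is nonzero (`kreinDenom_ne_zero`); `γ = 0` gives the Wronskian.

For `f` continuous with compact support in `(0,∞)`, variation of constants gives a solution `u`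
(`greenFun`) of `-u'' + (V - k) u = f`, smooth enough across `R`, a multiple of `F` near `0` and of
`G` near infinity. It is the free resolvent applied to `f`. The function `φ` solves the homogeneous
equation off `R`, has a continuous derivative `M G' F'` at `R`, and jumps there by `M (G F' - G' F)
= 1`. Hence `u + c φ` satisfies the `δ'`-condition when `c = γ (u'(R) + c M G' F')`, that is, `c = μ
u'(R)`. Differentiating the Green kernel gives `u'(R) = ∫ φ(k) f`, which is the scalar product with
`φ(k̄)` because `φ(k̄)` is the conjugate of `φ(k)`. Since such `f` are dense and the resolvents are
bounded by hypothesis, the formula extends to all of `L²` (`opResolvent_radialOp_krein`).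
Self-adjointness is never needed.

In the plane, the resolvent of a direct sum acts mode by mode. Existence of that resolvent already
forces every `ψ` to be the sum of its modes (`hasSum_adjoint_of_mem_opResolventSet`), so
completeness of the angular functions needs no separate proof; applying the two bounded resolvents
termwise gives the series.

The special functions are handled through contiguous relations: coefficient identities for `₁F₁`,
and Laplace integrals continued by a recursion in `a` for `U`. -/

theorem isResolventAt_iff_graph {T : E →ₗ.[ℂ] E} {k : ℂ} {S : E →L[ℂ] E} :
    IsResolventAt T k S ↔ (∀ x, (S x, x + k • S x) ∈ T.graph) ∧
      ∀ u v, (u, v) ∈ T.graph → S (v - k • u) = u := by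
  constructor
  · rintro ⟨h1, h2⟩
    refine ⟨fun x => ?_, fun u v huv => ?_⟩
    · obtain ⟨h, hx⟩ := h1 x
      rw [LinearPMap.mem_graph_iff]
      exact ⟨⟨S x, h⟩, rfl, sub_eq_iff_eq_add.1 hx⟩
    · rw [LinearPMap.mem_graph_iff] at huv
      obtain ⟨y, rfl, rfl⟩ := huv
      exact h2 y
  · rintro ⟨h1, h2⟩
    refine ⟨fun x => ?_, fun u => h2 _ _ (T.mem_graph u)⟩
    obtain ⟨y, hy, hy'⟩ := (LinearPMap.mem_graph_iff T).1 (h1 x)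
    simp only at hy hy'
    have hm : S x ∈ T.domain := hy ▸ y.2
    have : (⟨S x, hm⟩ : T.domain) = y := Subtype.ext hy.symm
    exact ⟨hm, by rw [this, hy', add_sub_cancel_right]⟩

theorem IsResolventAt.unique {T : E →ₗ.[ℂ] E} {k : ℂ} {S S' : E →L[ℂ] E}
    (h : IsResolventAt T k S) (h' : IsResolventAt T k S') : S = S' := by
  ext x
  have := (isResolventAt_iff_graph.1 h').2 _ _ ((isResolventAt_iff_graph.1 h).1 x)
  rw [add_sub_cancel_right] at this
  exact this.symm

theorem IsResolventAt.opResolvent_eq {T : E →ₗ.[ℂ] E} {k : ℂ} {S : E →L[ℂ] E}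
    (h : IsResolventAt T k S) : opResolvent T k = S := by
  have hex : ∃ S : E →L[ℂ] E, IsResolventAt T k S := ⟨S, h⟩
  rw [opResolvent, dif_pos hex]
  exact hex.choose_spec.unique h

theorem isResolventAt_opResolvent {T : E →ₗ.[ℂ] E} {k : ℂ} (h : k ∈ opResolventSet T) :
    IsResolventAt T k (opResolvent T k) := by
  obtain ⟨S, hS⟩ := h
  rwa [hS.opResolvent_eq]

theorem opResolvent_eq_of_mem_graph {T : E →ₗ.[ℂ] E} {k : ℂ} (h : k ∈ opResolventSet T)
    {u f : E} (hu : (u, f + k • u) ∈ T.graph) : opResolvent T k f = u := by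
  have := (isResolventAt_iff_graph.1 (isResolventAt_opResolvent h)).2 _ _ hu
  rwa [add_sub_cancel_right] at this

/-- The absence of eigenvectors at `k` is the spectral input behind the nonvanishing of the
Wronskian and of the brackets. -/
theorem eq_zero_of_mem_graph_smul {T : E →ₗ.[ℂ] E} {k : ℂ} (h : k ∈ opResolventSet T)
    {u : E} (hu : (u, k • u) ∈ T.graph) : u = 0 := by
  rw [← opResolvent_eq_of_mem_graph h (f := 0) (u := u) (by rwa [zero_add]), map_zero]

theorem mem_graph_diagOp {G : Type*} [NormedAddCommGroup G] [InnerProductSpace ℂ G]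
    {T : Fin 2 → G →ₗ.[ℂ] G} {u v : PiLp 2 (fun _ : Fin 2 => G)} :
    (u, v) ∈ (diagOp T).graph ↔ ∀ i, (u i, v i) ∈ (T i).graph := by
  rw [LinearPMap.mem_graph_iff]
  constructor
  · rintro ⟨y, rfl, rfl⟩ i
    exact (T i).mem_graph ⟨_, y.2 i⟩
  · intro h
    have h' : ∀ i, ∃ y : (T i).domain, (y : G) = u i ∧ T i y = v i := fun i =>
      (LinearPMap.mem_graph_iff _).1 (h i)
    have hu : u ∈ (diagOp T).domain := by
      intro i
      obtain ⟨y, hy, -⟩ := h' i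
      exact hy ▸ y.2
    refine ⟨⟨u, hu⟩, rfl, ?_⟩
    ext1 i
    obtain ⟨y, hy, hy'⟩ := h' i
    have : (⟨u i, hu i⟩ : (T i).domain) = y := Subtype.ext hy.symm
    change T i ⟨u i, hu i⟩ = v i
    rw [this, hy']

/-- The graph of `diagOp T` is described componentwise, so compressing the full resolvent to
component `i` inverts `T i - k`. -/
theorem mem_opResolventSet_of_diagOp {G : Type*} [NormedAddCommGroup G] [InnerProductSpace ℂ G]
    {T : Fin 2 → G →ₗ.[ℂ] G} {k : ℂ} (h : k ∈ opResolventSet (diagOp T)) (i : Fin 2) :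
    k ∈ opResolventSet (T i) := by
  obtain ⟨S, hS⟩ := h
  obtain ⟨h1, h2⟩ := isResolventAt_iff_graph.1 hS
  let J : G →L[ℂ] PiLp 2 (fun _ : Fin 2 => G) :=
    ((PiLp.continuousLinearEquiv 2 ℂ (fun _ : Fin 2 => G)).symm :
      (Fin 2 → G) →L[ℂ] PiLp 2 (fun _ : Fin 2 => G)) ∘L ContinuousLinearMap.single ℂ (fun _ : Fin 2 => G) i
  have hJ : ∀ x, J x = PiLp.single 2 i x := fun x => rfl
  refine ⟨(PiLp.proj 2 (fun _ : Fin 2 => G) i) ∘L S ∘L J, isResolventAt_iff_graph.2 ⟨?_, ?_⟩⟩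
  · intro x
    have := mem_graph_diagOp.1 (h1 (J x)) i
    simpa [hJ] using this
  · intro u v huv
    have hm : (PiLp.single 2 i u, PiLp.single 2 i v) ∈ (diagOp T).graph := by
      rw [mem_graph_diagOp]
      intro j
      by_cases hj : j = i
      · subst hj
        simpa using huv
      · rw [PiLp.single_eq_of_ne 2 hj, PiLp.single_eq_of_ne 2 hj]
        exact (T j).graph.zero_mem
    have h3 := h2 _ _ hm
    have h4 : PiLp.single 2 i v - k • PiLp.single 2 i u = J (v - k • u) := by
      rw [map_sub, map_smul]
      rfl
    rw [h4] at h3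
    change S (J (v - k • u)) i = u
    rw [h3, PiLp.single_eq_same]

theorem isResolventAt_diagOp {G : Type*} [NormedAddCommGroup G] [InnerProductSpace ℂ G]
    {T : Fin 2 → G →ₗ.[ℂ] G} {k : ℂ} (h : ∀ i, k ∈ opResolventSet (T i)) :
    ∃ S, IsResolventAt (diagOp T) k S ∧ ∀ f i, S f i = opResolvent (T i) k (f i) := by
  let S : PiLp 2 (fun _ : Fin 2 => G) →L[ℂ] PiLp 2 (fun _ : Fin 2 => G) :=
    ((PiLp.continuousLinearEquiv 2 ℂ (fun _ : Fin 2 => G)).symm :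
      (Fin 2 → G) →L[ℂ] PiLp 2 (fun _ : Fin 2 => G)) ∘L
      ContinuousLinearMap.pi fun i => opResolvent (T i) k ∘L PiLp.proj 2 (fun _ : Fin 2 => G) i
  have hS : ∀ f i, S f i = opResolvent (T i) k (f i) := fun f i => rfl
  refine ⟨S, isResolventAt_iff_graph.2 ⟨fun x => mem_graph_diagOp.2 fun i => ?_,
    fun u v huv => ?_⟩, hS⟩
  · exact (isResolventAt_iff_graph.1 (isResolventAt_opResolvent (h i))).1 (x i)
  · ext1 i
    exact (isResolventAt_iff_graph.1 (isResolventAt_opResolvent (h i))).2 _ _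
      (mem_graph_diagOp.1 huv i)

theorem mem_opResolventSet_diagOp {G : Type*} [NormedAddCommGroup G] [InnerProductSpace ℂ G]
    {T : Fin 2 → G →ₗ.[ℂ] G} {k : ℂ} (h : ∀ i, k ∈ opResolventSet (T i)) :
    k ∈ opResolventSet (diagOp T) :=
  let ⟨S, hS, _⟩ := isResolventAt_diagOp h
  ⟨S, hS⟩

theorem opResolvent_diagOp_apply {G : Type*} [NormedAddCommGroup G] [InnerProductSpace ℂ G]
    {T : Fin 2 → G →ₗ.[ℂ] G} {k : ℂ} (h : k ∈ opResolventSet (diagOp T))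
    (f : PiLp 2 (fun _ : Fin 2 => G)) (i : Fin 2) :
    opResolvent (diagOp T) k f i = opResolvent (T i) k (f i) := by
  obtain ⟨S, hS, h'⟩ := isResolventAt_diagOp fun i => mem_opResolventSet_of_diagOp h i
  rw [hS.opResolvent_eq, h']

variable [CompleteSpace E] {ι : Type*} {G : ι → Type*} [∀ i, NormedAddCommGroup (G i)]
  [∀ i, InnerProductSpace ℂ (G i)] {V : ∀ i, G i →ₗᵢ[ℂ] E}

theorem mem_directSumGraph_of_mem_graph (hV : OrthogonalFamily ℂ G V)
    {T : ∀ i, G i →ₗ.[ℂ] G i} {i : ι} {u v : G i} (h : (u, v) ∈ (T i).graph) :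
    (V i u, V i v) ∈ (directSumOp hV T).graph := by
  classical
  rw [directSumOp_graph]
  refine ⟨lp.single 2 i u, lp.single 2 i v, hV.linearIsometry_apply_single u,
    hV.linearIsometry_apply_single v, fun j => ?_⟩
  by_cases hj : j = i
  · subst hj
    simpa using h
  · rw [lp.single_apply_ne _ _ _ hj, lp.single_apply_ne _ _ _ hj]
    exact (T j).graph.zero_mem

variable [∀ i, CompleteSpace (G i)]

theorem adjoint_apply_linearIsometry (hV : OrthogonalFamily ℂ G V) (h : lp G 2) (i : ι) :
    ContinuousLinearMap.adjoint (V i).toContinuousLinearMap (hV.linearIsometry h) = h i := by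
  classical
  refine ext_inner_left ℂ fun x => ?_
  rw [ContinuousLinearMap.adjoint_inner_right]
  change ⟪V i x, _⟫_ℂ = _
  rw [← hV.linearIsometry_apply_single, LinearIsometry.inner_map_map, lp.inner_single_left]

theorem adjoint_apply_self (i : ι) (x : G i) :
    ContinuousLinearMap.adjoint (V i).toContinuousLinearMap (V i x) = x := by
  refine ext_inner_left ℂ fun y => ?_
  rw [ContinuousLinearMap.adjoint_inner_right]
  exact (V i).inner_map_map y x

/-- The inverse is the compression `V i* S V i`: the adjoint reads off the `i`-th coordinate of a
graph element. That `S` maps the range of `V i` to itself then follows because `V i (S' x)` is also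
a solution of the equation that `S (V i x)` solves, and `S` is a left inverse. -/
theorem exists_isResolventAt_of_directSumOp (hV : OrthogonalFamily ℂ G V)
    {T : ∀ i, G i →ₗ.[ℂ] G i} {k : ℂ} {S : E →L[ℂ] E} (hS : IsResolventAt (directSumOp hV T) k S)
    (i : ι) : ∃ S' : G i →L[ℂ] G i, IsResolventAt (T i) k S' ∧ ∀ x, S (V i x) = V i (S' x) := by
  classical
  obtain ⟨h1, h2⟩ := isResolventAt_iff_graph.1 hS
  let W := ContinuousLinearMap.adjoint (V i).toContinuousLinearMap
  let S' : G i →L[ℂ] G i := W ∘L S ∘L (V i).toContinuousLinearMap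
  have key : ∀ y, (S' y, y + k • S' y) ∈ (T i).graph := by
    intro y
    have := h1 (V i y)
    rw [directSumOp_graph] at this
    obtain ⟨f, g, hf, hg, hfg⟩ := this
    have hf' : S' y = f i := by
      rw [← adjoint_apply_linearIsometry hV f i, hf]
      rfl
    have hg' : y + k • S' y = g i := by
      rw [← adjoint_apply_linearIsometry hV g i, hg, map_add, map_smul, adjoint_apply_self]
      rfl
    exact (Prod.ext hf' hg' : (S' y, y + k • S' y) = (f i, g i)) ▸ hfg i
  refine ⟨S', isResolventAt_iff_graph.2 ⟨key, fun u v huv => ?_⟩, fun y => ?_⟩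
  · have := h2 _ _ (mem_directSumGraph_of_mem_graph hV huv)
    rw [← map_smul, ← map_sub] at this
    change W (S (V i (v - k • u))) = u
    rw [this]
    exact adjoint_apply_self i u
  · have := h2 _ _ (mem_directSumGraph_of_mem_graph hV (key y))
    rwa [← map_smul (V i), ← map_sub (V i), add_sub_cancel_right] at this

theorem mem_opResolventSet_of_directSumOp (hV : OrthogonalFamily ℂ G V)
    {T : ∀ i, G i →ₗ.[ℂ] G i} {k : ℂ} (h : k ∈ opResolventSet (directSumOp hV T)) (i : ι) :
    k ∈ opResolventSet (T i) := by
  obtain ⟨S, hS⟩ := h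
  obtain ⟨S', h', -⟩ := exists_isResolventAt_of_directSumOp hV hS i
  exact ⟨S', h'⟩

theorem opResolvent_directSumOp_apply (hV : OrthogonalFamily ℂ G V)
    {T : ∀ i, G i →ₗ.[ℂ] G i} {k : ℂ} (h : k ∈ opResolventSet (directSumOp hV T)) (i : ι)
    (x : G i) : opResolvent (directSumOp hV T) k (V i x) = V i (opResolvent (T i) k x) := by
  obtain ⟨S', h', hx⟩ := exists_isResolventAt_of_directSumOp hV (isResolventAt_opResolvent h) i
  rw [hx, h'.opResolvent_eq]

/-- The ranges of the embeddings are total as soon as the direct sum has a resolvent. -/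
theorem hasSum_adjoint_of_mem_opResolventSet (hV : OrthogonalFamily ℂ G V)
    {T : ∀ i, G i →ₗ.[ℂ] G i} {k : ℂ} (h : k ∈ opResolventSet (directSumOp hV T)) (ψ : E) :
    HasSum (fun i => V i (ContinuousLinearMap.adjoint (V i).toContinuousLinearMap ψ)) ψ := by
  have := (isResolventAt_iff_graph.1 (isResolventAt_opResolvent h)).1 ψ
  rw [directSumOp_graph] at this
  obtain ⟨f, g, hf, hg, -⟩ := this
  -- Writing `ψ = T u - k u`, both `u` and `T u` are sums of modes by definition of the graph, hence
  -- so is `ψ`.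
  have hψ : hV.linearIsometry (g - k • f) = ψ := by
    rw [map_sub, map_smul, hf, hg, add_sub_cancel_right]
  rw [← hψ]
  simp only [adjoint_apply_linearIsometry]
  exact hV.hasSum_linearIsometry _

end AbstractResolvents

/-! ### Kummer's function: contiguous relations and differential equation -/

section Kummer

open Complex (regularizedHGFun regularizedHGFunCoeff regularizedHGFunSeries)

theorem hasSum_of_forall_eq {ι M : Type*} [AddCommMonoid M] [TopologicalSpace M] {f g : ι → M}
    {s : M} (h : ∀ n, f n = g n) (hg : HasSum g s) : HasSum f s :=
  (funext h : f = g) ▸ hg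

theorem coeff_kummer (a b : ℂ) (n : ℕ) : regularizedHGFunCoeff {a} {b} n =
    (ascPochhammer ℂ n).eval a * ((n.factorial : ℂ)⁻¹ * (Complex.Gamma (b + n))⁻¹) := by
  simp [regularizedHGFunCoeff, div_eq_mul_inv, mul_comm]

theorem hasFPowerSeries_kummer (a b : ℂ) : HasFPowerSeriesOnBall (regularizedHGFun {a} {b})
    (regularizedHGFunSeries {a} {b}) 0 ⊤ := by
  have h := Complex.radius_regularizedHGFunSeries_eq_top (a := {a}) (b := {b}) (by simp)
  have := (regularizedHGFunSeries {a} {b}).hasFPowerSeriesOnBall (by rw [h]; exact ENNReal.zero_lt_top)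
  rwa [h] at this

theorem hasSum_kummer (a b z : ℂ) :
    HasSum (fun n : ℕ => regularizedHGFunCoeff {a} {b} n * z ^ n) (regularizedHGFun {a} {b} z) := by
  have := (hasFPowerSeries_kummer a b).hasSum (y := z) (by simp)
  rw [zero_add] at this
  refine hasSum_of_forall_eq (fun n => ?_) this
  rw [FormalMultilinearSeries.apply_eq_pow_smul_coeff, Complex.regularizedHGFunSeries_coeff,
    smul_eq_mul, mul_comm]

theorem coeff_kummer_succ (a b : ℂ) (n : ℕ) :
    (n + 1) * regularizedHGFunCoeff {a} {b} (n + 1) = a * regularizedHGFunCoeff {a + 1} {b + 1} n := by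
  rw [coeff_kummer, coeff_kummer, ascPochhammer_succ_left, Nat.factorial_succ]
  have : (n + 1 : ℂ) ≠ 0 := by exact_mod_cast n.succ_ne_zero
  have h2 : b + ((n + 1 : ℕ) : ℂ) = b + 1 + n := by push_cast; ring
  rw [h2]
  simp only [Polynomial.eval_mul, Polynomial.eval_X, Polynomial.eval_comp, Polynomial.eval_add,
    Polynomial.eval_one]
  push_cast
  field_simp

theorem hasDerivAt_regularizedHGFun (a b z : ℂ) :
    HasDerivAt (regularizedHGFun {a} {b}) (a * regularizedHGFun {a + 1} {b + 1} z) z := by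
  have hd : DifferentiableAt ℂ (regularizedHGFun {a} {b}) z :=
    (hasFPowerSeries_kummer a b).analyticOnNhd z (by simp) |>.differentiableAt
  have h1 := (hasFPowerSeries_kummer a b).fderiv.hasSum (y := z) (by simp)
  rw [zero_add] at h1
  have h2 := h1.mapL (ContinuousLinearMap.apply ℂ ℂ (1 : ℂ))
  have h4 : HasSum (fun n : ℕ => a * (regularizedHGFunCoeff {a + 1} {b + 1} n * z ^ n))
      (fderiv ℂ (regularizedHGFun {a} {b}) z 1) := by
    refine hasSum_of_forall_eq (fun n => ?_) h2
    have := (regularizedHGFunSeries {a} {b}).derivSeries_coeff_one n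
    rw [Complex.regularizedHGFunSeries_coeff, nsmul_eq_mul, Nat.cast_add, Nat.cast_one,
      coeff_kummer_succ] at this
    rw [FormalMultilinearSeries.apply_eq_pow_smul_coeff]
    simp only [ContinuousLinearMap.apply_apply, _root_.smul_apply, smul_eq_mul, this]
    ring
  have h5 := h4.unique ((hasSum_kummer (a + 1) (b + 1) z).mul_left a)
  rw [← h5, fderiv_apply_one_eq_deriv]
  exact hd.hasDerivAt

/-- The operator `z d/dz` multiplies the `n`-th coefficient by `n`; this turns the contiguous
relations below into identities between coefficients. -/
theorem hasSum_kummer_euler (a b z : ℂ) :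
    HasSum (fun n : ℕ => n * regularizedHGFunCoeff {a} {b} n * z ^ n)
      (z * (a * regularizedHGFun {a + 1} {b + 1} z)) := by
  rw [← hasSum_nat_add_iff' 1]
  simp only [Finset.sum_range_one, Nat.cast_zero, zero_mul, sub_zero]
  refine hasSum_of_forall_eq (fun n => ?_)
    (((hasSum_kummer (a + 1) (b + 1) z).mul_left a).mul_left z)
  have := coeff_kummer_succ a b n
  push_cast
  linear_combination z ^ (n + 1) * this

theorem kummer_contiguous_left (a b z : ℂ) :
    z * (a * regularizedHGFun {a + 1} {b + 1} z) + a * regularizedHGFun {a} {b} z =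
      a * regularizedHGFun {a + 1} {b} z := by
  have h := (hasSum_kummer_euler a b z).add ((hasSum_kummer a b z).mul_left a)
  refine h.unique (hasSum_of_forall_eq (fun n => ?_) ((hasSum_kummer (a + 1) b z).mul_left a))
  have h2 : (ascPochhammer ℂ n).eval a * (a + n) = a * (ascPochhammer ℂ n).eval (a + 1) := by
    rw [← ascPochhammer_succ_eval, ascPochhammer_succ_left]
    simp
  rw [coeff_kummer, coeff_kummer]
  linear_combination ((n.factorial : ℂ)⁻¹ * (Complex.Gamma (b + n))⁻¹) * z ^ n * h2

/-- The coefficients match by `1/Γ(s) = s/Γ(s+1)`, which with `1/0 = 0` holds at the poles as well,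
so `b` is unrestricted. -/
theorem kummer_contiguous_right (a b z : ℂ) :
    z * (a * regularizedHGFun {a + 1} {b + 1 + 1} z) + b * regularizedHGFun {a} {b + 1} z =
      regularizedHGFun {a} {b} z := by
  have h := (hasSum_kummer_euler a (b + 1) z).add ((hasSum_kummer a (b + 1) z).mul_left b)
  refine h.unique (hasSum_of_forall_eq (fun n => ?_) (hasSum_kummer a b z))
  have h2 := Complex.one_div_Gamma_eq_self_mul_one_div_Gamma_add_one (b + n)
  rw [coeff_kummer, coeff_kummer]
  have h3 : b + 1 + (n : ℂ) = b + n + 1 := by ring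
  rw [h3]
  linear_combination -(ascPochhammer ℂ n).eval a * (n.factorial : ℂ)⁻¹ * z ^ n * h2

theorem ascPochhammer_eval_conj (a : ℂ) (n : ℕ) :
    (ascPochhammer ℂ n).eval (conj a) = conj ((ascPochhammer ℂ n).eval a) := by
  induction n with
  | zero => simp
  | succ n ih => rw [ascPochhammer_succ_eval, ascPochhammer_succ_eval, ih]; simp

theorem regularizedHGFun_conj (a b z : ℂ) :
    regularizedHGFun {conj a} {conj b} (conj z) = conj (regularizedHGFun {a} {b} z) := by
  have h := Complex.hasSum_conj'.2 (hasSum_kummer a b z)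
  refine (hasSum_kummer (conj a) (conj b) (conj z)).unique (hasSum_of_forall_eq (fun n => ?_) h)
  rw [coeff_kummer, coeff_kummer, ascPochhammer_eval_conj]
  have : conj b + (n : ℂ) = conj (b + n) := by simp
  rw [this, Complex.Gamma_conj]
  simp

theorem kummerM_hasDerivAt (a b z : ℂ) (hb : b ≠ 0) :
    HasDerivAt (kummerM a b) (a / b * kummerM (a + 1) (b + 1) z) z := by
  unfold kummerM
  refine ((hasDerivAt_regularizedHGFun a b z).const_mul (Complex.Gamma b)).congr_deriv ?_
  rw [Complex.Gamma_add_one b hb]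
  field_simp

/-- The two contiguous relations express the same function, with parameters `a + 1` and `b`, in
terms of derivatives; equating them is Kummer's equation. -/
theorem kummerM_ode (a b z : ℂ) (hb : b ≠ 0) (hb' : b + 1 ≠ 0) :
    z * (a / b * ((a + 1) / (b + 1) * kummerM (a + 1 + 1) (b + 1 + 1) z)) +
      (b - z) * (a / b * kummerM (a + 1) (b + 1) z) - a * kummerM a b z = 0 := by
  have h1 := kummer_contiguous_left a b z
  have h2 := kummer_contiguous_right (a + 1) b z
  unfold kummerM
  rw [Complex.Gamma_add_one (b + 1) hb', Complex.Gamma_add_one b hb]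
  field_simp
  linear_combination Complex.Gamma b * a * h2 - Complex.Gamma b * h1

theorem kummerM_zero (a b : ℂ) (hb : Complex.Gamma b ≠ 0) : kummerM a b 0 = 1 := by
  have h := (hasSum_kummer a b 0).unique (hasSum_single 0 fun n hn => by simp [hn])
  rw [kummerM, h, coeff_kummer]
  simp [hb]

theorem kummerM_conj (a b z : ℂ) : kummerM (conj a) (conj b) (conj z) = conj (kummerM a b z) := by
  rw [kummerM, kummerM, Complex.Gamma_conj, regularizedHGFun_conj, map_mul]

end Kummer

/-! ### Laplace integrals for Tricomi's function, in the range of convergence -/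

section Tricomi

theorem exists_one_add_rpow_le (p : ℝ) {ε : ℝ} (hε : 0 < ε) :
    ∃ C : ℝ, 0 < C ∧ ∀ t : ℝ, 0 ≤ t → (1 + t) ^ p ≤ C * Real.exp (ε * t) := by
  have hp : 0 < |p| + 1 := by positivity
  -- `δ ≤ 1` gives `1 + t ≤ δ⁻¹ e^(δt)`, and `δ |p| ≤ ε` keeps the `|p|`-th power of this below
  -- `e^(εt)` up to a constant.
  set δ : ℝ := min 1 (ε / (|p| + 1)) with hδ
  have hδ0 : 0 < δ := lt_min one_pos (by positivity)
  have hδ1 : δ ≤ 1 := min_le_left _ _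
  have hδ2 : δ * (|p| + 1) ≤ ε := by
    rw [← le_div_iff₀ hp]
    exact min_le_right _ _
  refine ⟨δ⁻¹ ^ |p|, by positivity, fun t ht => ?_⟩
  have h1 : 1 + t ≤ δ⁻¹ * Real.exp (δ * t) := by
    rw [inv_mul_eq_div, le_div_iff₀ hδ0]
    have := Real.add_one_le_exp (δ * t)
    nlinarith
  calc (1 + t) ^ p ≤ (1 + t) ^ |p| :=
        Real.rpow_le_rpow_of_exponent_le (by linarith) (le_abs_self p)
    _ ≤ (δ⁻¹ * Real.exp (δ * t)) ^ |p| :=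
        Real.rpow_le_rpow (by linarith) h1 (abs_nonneg p)
    _ = δ⁻¹ ^ |p| * Real.exp (δ * t * |p|) := by
        rw [Real.mul_rpow (by positivity) (by positivity), ← Real.exp_mul]
    _ ≤ δ⁻¹ ^ |p| * Real.exp (ε * t) := by
        refine mul_le_mul_of_nonneg_left (Real.exp_le_exp.2 ?_) (by positivity)
        nlinarith [mul_nonneg hδ0.le ht, mul_le_mul_of_nonneg_right hδ2 ht]

theorem cpow_add_one {z w : ℂ} (hz : z ≠ 0) : z ^ (w + 1) = z ^ w * z := by
  rw [Complex.cpow_add _ _ hz, Complex.cpow_one]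

theorem hasDerivAt_ofReal_cpow (A : ℂ) {t : ℝ} (ht : 0 < t) :
    HasDerivAt (fun y : ℝ => (y : ℂ) ^ A) (A * (t : ℂ) ^ (A - 1)) t := by
  have h := ((hasDerivAt_id (t : ℂ)).cpow_const (c := A)
    (Or.inl (by simpa using ht))).comp_ofReal
  simpa using h

theorem hasDerivAt_one_add_cpow (c : ℂ) {t : ℝ} (ht : 0 < 1 + t) :
    HasDerivAt (fun y : ℝ => ((1 + y : ℝ) : ℂ) ^ c) (c * ((1 + t : ℝ) : ℂ) ^ (c - 1)) t := by
  have h := HasDerivAt.comp_const_add 1 t (hasDerivAt_ofReal_cpow c ht)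
  exact h

/-- The integrand `t^(A-1) e^(-xt) (1+t)^c`. -/
def laplaceKernel (A c : ℂ) (x t : ℝ) : ℂ :=
  (t : ℂ) ^ (A - 1) * (Complex.exp (-(x * t)) * ((1 + t : ℝ) : ℂ) ^ c)

/-- The integral `∫₀^∞ t^(A-1) e^(-xt) (1+t)^c dt`. -/
def laplaceI (A c : ℂ) (x : ℝ) : ℂ := ∫ t in Ioi (0 : ℝ), laplaceKernel A c x t

theorem norm_laplaceKernel (A c : ℂ) (x : ℝ) {t : ℝ} (ht : 0 < t) :
    ‖laplaceKernel A c x t‖ = t ^ (A.re - 1) * (Real.exp (-(x * t)) * (1 + t) ^ c.re) := by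
  rw [laplaceKernel, norm_mul, norm_mul, Complex.norm_cpow_eq_rpow_re_of_pos ht,
    Complex.norm_cpow_eq_rpow_re_of_pos (by linarith), Complex.norm_exp]
  simp

theorem continuousOn_laplaceKernel (A c : ℂ) (x : ℝ) :
    ContinuousOn (laplaceKernel A c x) (Ioi 0) := by
  intro t ht
  have ht' : (0 : ℝ) < t := ht
  refine ContinuousAt.continuousWithinAt ?_
  unfold laplaceKernel
  refine ContinuousAt.mul ?_ (ContinuousAt.mul (by fun_prop) ?_)
  · exact Complex.continuousAt_ofReal_cpow_const _ _ (Or.inr ht'.ne')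
  · have := Complex.continuousAt_ofReal_cpow_const (1 + t) c (Or.inr (by linarith))
    exact ContinuousAt.comp (f := fun t : ℝ => 1 + t) (x := t) this (by fun_prop)

theorem integrableOn_laplaceKernel {A : ℂ} (c : ℂ) {x : ℝ} (hA : 0 < A.re) (hx : 0 < x) :
    IntegrableOn (laplaceKernel A c x) (Ioi 0) := by
  obtain ⟨C, hC, h⟩ := exists_one_add_rpow_le c.re (half_pos hx)
  have h1 : IntegrableOn (fun t : ℝ => C * (t ^ (A.re - 1) * Real.exp (-(x / 2) * t ^ (1 : ℝ))))
      (Ioi 0) :=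
    (integrableOn_rpow_mul_exp_neg_mul_rpow (by linarith) one_pos (half_pos hx)).const_mul C
  refine h1.mono' ((continuousOn_laplaceKernel A c x).aestronglyMeasurable measurableSet_Ioi) ?_
  filter_upwards [ae_restrict_mem measurableSet_Ioi] with t ht
  have ht' : (0 : ℝ) < t := ht
  rw [norm_laplaceKernel A c x ht', Real.rpow_one]
  have h2 : Real.exp (-(x * t)) * (1 + t) ^ c.re ≤ C * Real.exp (-(x / 2) * t) := by
    calc _ ≤ Real.exp (-(x * t)) * (C * Real.exp (x / 2 * t)) := by gcongr; exact h t ht'.le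
      _ = C * (Real.exp (-(x * t)) * Real.exp (x / 2 * t)) := by ring
      _ = _ := by rw [← Real.exp_add]; ring_nf
  calc _ ≤ t ^ (A.re - 1) * (C * Real.exp (-(x / 2) * t)) := by gcongr
    _ = _ := by ring

theorem neg_mul_laplaceKernel (A c : ℂ) (x : ℝ) {t : ℝ} (ht : 0 < t) :
    -(t : ℂ) * laplaceKernel A c x t = -laplaceKernel (A + 1) c x t := by
  have h : (t : ℂ) ^ (A + 1 - 1) = t ^ (A - 1) * t := by
    rw [← cpow_add_one (by exact_mod_cast ht.ne')]
    ring_nf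
  rw [laplaceKernel, laplaceKernel, h]
  ring

/-- Differentiation under the integral brings down a factor `-t`, which raises `A` by one. For `y >
x/2` the integrand is dominated by its value at `x/2`, since `e^(-yt)` decreases in `y`. -/
theorem hasDerivAt_laplaceI {A : ℂ} (c : ℂ) {x : ℝ} (hA : 0 < A.re) (hx : 0 < x) :
    HasDerivAt (laplaceI A c) (-laplaceI (A + 1) c x) x := by
  have hA1 : 0 < (A + 1).re := by simp; linarith
  have key := hasDerivAt_integral_of_dominated_loc_of_deriv_le (μ := volume.restrict (Ioi (0 : ℝ)))
    (F := fun x t => laplaceKernel A c x t) (F' := fun x t => -laplaceKernel (A + 1) c x t)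
    (x₀ := x) (s := Ioi (x / 2)) (bound := fun t => ‖laplaceKernel (A + 1) c (x / 2) t‖)
    (Ioi_mem_nhds (by linarith))
    (Eventually.of_forall fun y =>
      (continuousOn_laplaceKernel A c y).aestronglyMeasurable measurableSet_Ioi)
    (integrableOn_laplaceKernel c hA hx)
    ((continuousOn_laplaceKernel (A + 1) c x).aestronglyMeasurable measurableSet_Ioi).neg
    ?_ (integrableOn_laplaceKernel c hA1 (half_pos hx)).norm ?_
  · have h2 := key.2
    rw [integral_neg] at h2
    exact h2
  · filter_upwards [ae_restrict_mem measurableSet_Ioi] with t ht y hy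
    have ht' : (0 : ℝ) < t := ht
    have hy' : x / 2 < y := hy
    rw [norm_neg, norm_laplaceKernel _ _ _ ht', norm_laplaceKernel _ _ _ ht']
    gcongr
  · filter_upwards [ae_restrict_mem measurableSet_Ioi] with t ht y hy
    rw [← neg_mul_laplaceKernel A c y ht]
    have h1 : HasDerivAt (fun y : ℝ => Complex.exp (-(y * t)))
        (Complex.exp (-(y * t)) * (-(1 * t))) y :=
      (((Complex.ofRealCLM.hasDerivAt (x := y)).mul_const (t : ℂ)).neg).cexp
    refine ((h1.mul_const _).const_mul _).congr_deriv ?_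
    rw [laplaceKernel]
    ring

theorem laplaceI_add_one_right {A : ℂ} (c : ℂ) {x : ℝ} (hA : 0 < A.re) (hx : 0 < x) :
    laplaceI A (c + 1) x = laplaceI A c x + laplaceI (A + 1) c x := by
  have hA1 : 0 < (A + 1).re := by simp; linarith
  rw [laplaceI, laplaceI, laplaceI,
    ← integral_add (integrableOn_laplaceKernel c hA hx) (integrableOn_laplaceKernel c hA1 hx)]
  refine setIntegral_congr_fun measurableSet_Ioi fun t ht => ?_
  have ht' : (0 : ℝ) < t := ht
  have h1 := neg_mul_laplaceKernel A c x ht'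
  have h2 : ((1 + t : ℝ) : ℂ) ^ (c + 1) = ((1 + t : ℝ) : ℂ) ^ c * (1 + t : ℝ) :=
    cpow_add_one (by exact_mod_cast (by linarith : (1 + t : ℝ) ≠ 0))
  have h3 : laplaceKernel (A + 1) c x t = t * laplaceKernel A c x t := by linear_combination h1
  simp only [h3]
  rw [laplaceKernel, laplaceKernel, h2]
  push_cast
  ring

/-- The derivative of `t^A e^(-xt) (1+t)^c` integrates to zero: the function vanishes at `0` because
`Re A > 0` and at infinity by exponential decay. -/
theorem laplaceI_parts {A : ℂ} (c : ℂ) {x : ℝ} (hA : 0 < A.re) (hx : 0 < x) :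
    A * laplaceI A c x = x * laplaceI (A + 1) c x - c * laplaceI (A + 1) (c - 1) x := by
  have hA1 : 0 < (A + 1).re := by simp; linarith
  have hA0 : A ≠ 0 := fun h => by simp [h] at hA
  have hi1 := (integrableOn_laplaceKernel c hA hx).const_mul A
  have hi2 := (integrableOn_laplaceKernel c hA1 hx).const_mul (x : ℂ)
  have hi3 := (integrableOn_laplaceKernel (c - 1) hA1 hx).const_mul c
  have key := integral_Ioi_of_hasDerivAt_of_tendsto (a := 0) (m := 0)
    (f := laplaceKernel (A + 1) c x)
    (f' := fun t => A * laplaceKernel A c x t - x * laplaceKernel (A + 1) c x t +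
      c * laplaceKernel (A + 1) (c - 1) x t) ?_ ?_ ((hi1.sub hi2).add hi3) ?_
  · have h0 : laplaceKernel (A + 1) c x 0 = 0 := by
      rw [laplaceKernel, add_sub_cancel_right, Complex.ofReal_zero, Complex.zero_cpow hA0, zero_mul]
    rw [h0, sub_zero] at key
    have h4 := integral_add (hi1.sub hi2) hi3
    have h5 := integral_sub hi1 hi2
    simp only [Pi.sub_apply] at h4
    rw [h4, h5, integral_const_mul, integral_const_mul, integral_const_mul] at key
    unfold laplaceI
    linear_combination key
  · refine ContinuousAt.continuousWithinAt ?_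
    unfold laplaceKernel
    refine ContinuousAt.mul ?_ (ContinuousAt.mul (by fun_prop) ?_)
    · exact Complex.continuousAt_ofReal_cpow_const _ _ (Or.inl (by simpa using hA))
    · have := Complex.continuousAt_ofReal_cpow_const (1 + 0) c (Or.inr (by norm_num))
      exact ContinuousAt.comp (f := fun t : ℝ => 1 + t) (x := 0) this (by fun_prop)
  · intro t ht
    have ht' : (0 : ℝ) < t := ht
    have h1 : HasDerivAt (fun y : ℝ => (y : ℂ) ^ (A + 1 - 1)) (A * (t : ℂ) ^ (A - 1)) t := by
      rw [add_sub_cancel_right]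
      exact hasDerivAt_ofReal_cpow A ht'
    have h2 : HasDerivAt (fun y : ℝ => ((1 + y : ℝ) : ℂ) ^ c)
        (c * ((1 + t : ℝ) : ℂ) ^ (c - 1)) t :=
      hasDerivAt_one_add_cpow c (by linarith)
    have h3 : HasDerivAt (fun y : ℝ => Complex.exp (-(x * y)))
        (Complex.exp (-(x * t)) * (-(x * 1))) t :=
      (((Complex.ofRealCLM.hasDerivAt (x := t)).const_mul (x : ℂ)).neg).cexp
    refine (h1.mul (h3.mul h2)).congr_deriv ?_
    rw [laplaceKernel, laplaceKernel, laplaceKernel]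
    simp only [Pi.mul_apply]
    ring
  · obtain ⟨C, hC, h⟩ := exists_one_add_rpow_le c.re (half_pos hx)
    have h1 : Tendsto (fun t : ℝ => C * (t ^ A.re * Real.exp (-(x / 2) * t))) atTop (𝓝 0) := by
      have := (tendsto_rpow_mul_exp_neg_mul_atTop_nhds_zero A.re (x / 2) (half_pos hx)).const_mul C
      rwa [mul_zero] at this
    refine squeeze_zero_norm' ?_ h1
    filter_upwards [eventually_gt_atTop 0] with t ht
    rw [norm_laplaceKernel _ _ _ ht]
    have h2 : Real.exp (-(x * t)) * (1 + t) ^ c.re ≤ C * Real.exp (-(x / 2) * t) := by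
      calc _ ≤ Real.exp (-(x * t)) * (C * Real.exp (x / 2 * t)) := by gcongr; exact h t ht.le
        _ = C * (Real.exp (-(x * t)) * Real.exp (x / 2 * t)) := by ring
        _ = _ := by rw [← Real.exp_add]; ring_nf
    calc _ ≤ t ^ ((A + 1).re - 1) * (C * Real.exp (-(x / 2) * t)) := by gcongr
      _ = _ := by
        rw [Complex.add_re, Complex.one_re, add_sub_cancel_right]
        ring

theorem conj_laplaceI (A c : ℂ) (x : ℝ) :
    laplaceI (conj A) (conj c) x = conj (laplaceI A c x) := by
  rw [laplaceI, laplaceI, ← integral_conj]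
  refine setIntegral_congr_fun measurableSet_Ioi fun t ht => ?_
  have ht' : (0 : ℝ) < t := ht
  have hc : ∀ (s : ℝ) (w : ℂ), 0 < s → (s : ℂ) ^ (conj w) = conj ((s : ℂ) ^ w) := by
    intro s w hs
    rw [Complex.cpow_conj _ _ (by rw [Complex.arg_ofReal_of_nonneg hs.le]; exact Real.pi_pos.ne),
      Complex.conj_ofReal]
  simp only [laplaceKernel, map_mul]
  rw [← hc t _ ht', ← hc (1 + t) _ (by linarith), ← Complex.exp_conj]
  simp

/-- The substitution `s = x t` leaves Euler's integral with the extra factor `(1 + s/x)^c`, which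
tends to `1` and for `x ≥ 1` is dominated by `(1+s)^|Re c|`. -/
theorem tendsto_laplaceI {A : ℂ} (c : ℂ) (hA : 0 < A.re) :
    Tendsto (fun x : ℝ => (x : ℂ) ^ A * laplaceI A c x) atTop (𝓝 (Complex.Gamma A)) := by
  have hsub : ∀ x : ℝ, 0 < x → (x : ℂ) ^ A * laplaceI A c x =
      ∫ s in Ioi (0 : ℝ), (s : ℂ) ^ (A - 1) * (Complex.exp (-s) * ((1 + s / x : ℝ) : ℂ) ^ c) := by
    intro x hx
    have hx0 : (x : ℂ) ≠ 0 := by exact_mod_cast hx.ne'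
    have h := integral_comp_mul_left_Ioi
      (fun s : ℝ => (s : ℂ) ^ (A - 1) * (Complex.exp (-s) * ((1 + s / x : ℝ) : ℂ) ^ c)) 0 hx
    rw [mul_zero] at h
    have h2 : ∫ t in Ioi (0 : ℝ), ((x * t : ℝ) : ℂ) ^ (A - 1) *
        (Complex.exp (-((x * t : ℝ) : ℂ)) * ((1 + x * t / x : ℝ) : ℂ) ^ c) =
        x ^ (A - 1) * laplaceI A c x := by
      rw [laplaceI, ← integral_const_mul]
      refine setIntegral_congr_fun measurableSet_Ioi fun t ht => ?_
      have ht' : (0 : ℝ) < t := ht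
      simp only [laplaceKernel]
      rw [mul_div_cancel_left₀ _ hx.ne', Complex.ofReal_mul,
        Complex.mul_cpow_ofReal_nonneg hx.le ht'.le]
      ring
    rw [h2] at h
    have h3 : (x : ℂ) ^ A = x ^ (A - 1) * x := by
      rw [← cpow_add_one hx0, sub_add_cancel]
    rw [h3, mul_right_comm, h]
    rw [Complex.real_smul, Complex.ofReal_inv]
    field_simp
  have hlim : Tendsto (fun x : ℝ => ∫ s in Ioi (0 : ℝ), (s : ℂ) ^ (A - 1) *
      (Complex.exp (-s) * ((1 + s / x : ℝ) : ℂ) ^ c)) atTop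
      (𝓝 (∫ s in Ioi (0 : ℝ), (s : ℂ) ^ (A - 1) * (Complex.exp (-s) * 1))) := by
    refine tendsto_integral_filter_of_dominated_convergence
      (fun s => ‖laplaceKernel A (|c.re| : ℝ) 1 s‖) ?_ ?_
      (integrableOn_laplaceKernel _ hA one_pos).norm ?_
    · filter_upwards [eventually_gt_atTop 0] with x hx
      refine ContinuousOn.aestronglyMeasurable (fun t ht => ?_) measurableSet_Ioi
      have ht' : (0 : ℝ) < t := ht
      refine ContinuousAt.continuousWithinAt ?_
      refine ContinuousAt.mul ?_ (ContinuousAt.mul (by fun_prop) ?_)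
      · exact Complex.continuousAt_ofReal_cpow_const _ _ (Or.inr ht'.ne')
      · have := Complex.continuousAt_ofReal_cpow_const (1 + t / x) c (Or.inr (by positivity))
        exact ContinuousAt.comp (f := fun t : ℝ => 1 + t / x) (x := t) this (by fun_prop)
    · filter_upwards [eventually_ge_atTop 1] with x hx
      filter_upwards [ae_restrict_mem measurableSet_Ioi] with t ht
      have ht' : (0 : ℝ) < t := ht
      have hx0 : 0 < x := by linarith
      rw [norm_laplaceKernel _ _ _ ht', norm_mul, norm_mul,
        Complex.norm_cpow_eq_rpow_re_of_pos ht',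
        Complex.norm_cpow_eq_rpow_re_of_pos (by positivity), Complex.norm_exp]
      simp only [Complex.sub_re, Complex.one_re, Complex.neg_re, Complex.ofReal_re, one_mul]
      gcongr
      calc (1 + t / x) ^ c.re ≤ (1 + t / x) ^ |c.re| :=
            Real.rpow_le_rpow_of_exponent_le (by linarith [div_pos ht' hx0]) (le_abs_self _)
        _ ≤ (1 + t) ^ |c.re| := by
            refine Real.rpow_le_rpow (by positivity) ?_ (abs_nonneg _)
            linarith [div_le_self ht'.le hx]
    · filter_upwards with t
      have h1 : Tendsto (fun x : ℝ => 1 + t / x) atTop (𝓝 1) := by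
        simpa using (tendsto_const_nhds (x := t)).div_atTop tendsto_id |>.const_add 1
      have h2 : Tendsto (fun x : ℝ => ((1 + t / x : ℝ) : ℂ) ^ c) atTop (𝓝 1) := by
        have h3 := (Complex.continuousAt_ofReal_cpow_const 1 c (Or.inr one_ne_zero)).tendsto
        have h4 := h3.comp h1
        simpa [Function.comp_def] using h4
      exact (h2.const_mul _).const_mul _
  have hG : ∫ s in Ioi (0 : ℝ), (s : ℂ) ^ (A - 1) * (Complex.exp (-s) * 1) = Complex.Gamma A := by
    have := Complex.integral_cpow_mul_exp_neg_mul_Ioi hA one_pos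
    simpa using this
  rw [← hG]
  refine hlim.congr' ?_
  filter_upwards [eventually_gt_atTop 0] with x hx
  exact (hsub x hx).symm

end Tricomi

/-! ### Continuation of Tricomi's function in its first parameter -/

section TricomiContinuation

/-- The continuation of the Laplace integral for Tricomi's function to `Re a > -N` by the
recursion `U(a, b) = x U(a + 1, b + 1) - (b - a - 1) U(a + 1, b)`. -/
def tricomiV : ℕ → ℂ → ℂ → ℝ → ℂ
  | 0, a, b, x => (Complex.Gamma a)⁻¹ * laplaceI a (b - a - 1) x
  | N + 1, a, b, x => x * tricomiV N (a + 1) (b + 1) x - (b - a - 1) * tricomiV N (a + 1) b x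

theorem ne_zero_of_re_pos {a : ℂ} (h : 0 < a.re) : a ≠ 0 := fun h0 => by simp [h0] at h

/-- The recursion that defines level `N + 1` already holds within level `N`, by integration by parts
when `N = 0`. Consequently the value does not depend on the admissible level, and each identity
below needs an integral only in its base case. -/
theorem tricomiV_contiguous_succ (N : ℕ) : ∀ (a b : ℂ) {x : ℝ}, 0 < a.re + N → 0 < x →
    tricomiV N a b x =
      x * tricomiV N (a + 1) (b + 1) x - (b - a - 1) * tricomiV N (a + 1) b x := by
  induction N with
  | zero =>
    intro a b x ha hx
    simp only [Nat.cast_zero, add_zero] at ha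
    have h := laplaceI_parts (b - a - 1) ha hx
    have ha0 := ne_zero_of_re_pos ha
    have hG : Complex.Gamma a ≠ 0 := Complex.Gamma_ne_zero_of_re_pos ha
    have e1 : b + 1 - (a + 1) - 1 = b - a - 1 := by ring
    have e2 : b - (a + 1) - 1 = b - a - 1 - 1 := by ring
    simp only [tricomiV]
    rw [Complex.Gamma_add_one a ha0, e1, e2]
    field_simp
    linear_combination h
  | succ N ih =>
    intro a b x ha hx
    have ha1 : 0 < (a + 1).re + N := by
      push_cast at ha
      simp only [Complex.add_re, Complex.one_re]
      linarith
    have ha2 : 0 < (a + 1 + 1).re + N := by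
      simp only [Complex.add_re, Complex.one_re] at ha1 ⊢
      linarith
    have h1 : ∀ b, tricomiV (N + 1) (a + 1) b x = tricomiV N (a + 1) b x := fun b =>
      (ih (a + 1) b ha1 hx).symm
    rw [h1, h1]
    rfl

theorem tricomiV_succ (N : ℕ) (a b : ℂ) {x : ℝ} (ha : 0 < a.re + N) (hx : 0 < x) :
    tricomiV (N + 1) a b x = tricomiV N a b x :=
  (tricomiV_contiguous_succ N a b ha hx).symm

/-- At level `0` this splits off one factor `1 + t` in the integrand; the recursion carries it to
higher levels. -/
theorem tricomiV_contiguous (N : ℕ) : ∀ (a b : ℂ) {x : ℝ}, 0 < a.re + N → 0 < x →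
    tricomiV N a (b + 1) x = tricomiV N a b x + a * tricomiV N (a + 1) (b + 1) x := by
  induction N with
  | zero =>
    intro a b x ha hx
    simp only [Nat.cast_zero, add_zero] at ha
    have h := laplaceI_add_one_right (b - a - 1) ha hx
    have ha0 := ne_zero_of_re_pos ha
    have hG : Complex.Gamma a ≠ 0 := Complex.Gamma_ne_zero_of_re_pos ha
    have e1 : b + 1 - (a + 1) - 1 = b - a - 1 := by ring
    have e2 : b + 1 - a - 1 = b - a - 1 + 1 := by ring
    simp only [tricomiV]
    rw [Complex.Gamma_add_one a ha0, e1, e2]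
    field_simp
    linear_combination h
  | succ N ih =>
    intro a b x ha hx
    have ha1 : 0 < (a + 1).re + N := by
      push_cast at ha
      simp only [Complex.add_re, Complex.one_re]
      linarith
    rw [tricomiV_succ N (a + 1) (b + 1) ha1 hx]
    simp only [tricomiV]
    have h1 := ih (a + 1) (b + 1) ha1 hx
    have h2 := ih (a + 1) b ha1 hx
    have h3 := tricomiV_contiguous_succ N (a + 1) (b + 1) ha1 hx
    linear_combination x * h1 - (a + 1) * h3 - (b - a - 1) * h2

theorem hasDerivAt_tricomiV (N : ℕ) : ∀ (a b : ℂ) {x : ℝ}, 0 < a.re + N → 0 < x →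
    HasDerivAt (tricomiV N a b) (-a * tricomiV N (a + 1) (b + 1) x) x := by
  induction N with
  | zero =>
    intro a b x ha hx
    simp only [Nat.cast_zero, add_zero] at ha
    have h := (hasDerivAt_laplaceI (b - a - 1) ha hx).const_mul (Complex.Gamma a)⁻¹
    have ha0 := ne_zero_of_re_pos ha
    have hG : Complex.Gamma a ≠ 0 := Complex.Gamma_ne_zero_of_re_pos ha
    have e1 : b + 1 - (a + 1) - 1 = b - a - 1 := by ring
    refine h.congr_deriv ?_
    simp only [tricomiV]
    rw [Complex.Gamma_add_one a ha0, e1]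
    field_simp
  | succ N ih =>
    intro a b x ha hx
    have ha1 : 0 < (a + 1).re + N := by
      push_cast at ha
      simp only [Complex.add_re, Complex.one_re]
      linarith
    have hid : HasDerivAt (fun y : ℝ => (y : ℂ)) 1 x := Complex.ofRealCLM.hasDerivAt
    have h := (hid.mul (ih (a + 1) (b + 1) ha1 hx)).sub
      ((ih (a + 1) b ha1 hx).const_mul (b - a - 1))
    refine h.congr_deriv ?_
    rw [tricomiV_succ N (a + 1) (b + 1) ha1 hx]
    have h3 := tricomiV_contiguous_succ N (a + 1) (b + 1) ha1 hx
    linear_combination (a + 1) * h3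

theorem tricomiV_ode (N : ℕ) (a b : ℂ) {x : ℝ} (ha : 0 < a.re + N) (hx : 0 < x) :
    x * (a * (a + 1) * tricomiV N (a + 1 + 1) (b + 1 + 1) x) +
      (b - x) * (-a * tricomiV N (a + 1) (b + 1) x) - a * tricomiV N a b x = 0 := by
  have ha1 : 0 < (a + 1).re + N := by
    simp only [Complex.add_re, Complex.one_re]
    linarith
  have h1 := tricomiV_contiguous N a b ha hx
  have h2 := tricomiV_contiguous N (a + 1) (b + 1) ha1 hx
  have h3 := tricomiV_contiguous_succ N a (b + 1) ha hx
  linear_combination -a * x * h2 - a * h3 + a * h1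

/-- In the recursion the first term carries the factor `x`, so it has the same normalization
`x^(a+1)` as the induction hypothesis; the second is smaller by a factor `1/x`. -/
theorem tendsto_tricomiV (N : ℕ) : ∀ (a b : ℂ), 0 < a.re + N →
    Tendsto (fun x : ℝ => (x : ℂ) ^ a * tricomiV N a b x) atTop (𝓝 1) := by
  induction N with
  | zero =>
    intro a b ha
    simp only [Nat.cast_zero, add_zero] at ha
    have h := (tendsto_laplaceI (b - a - 1) ha).const_mul (Complex.Gamma a)⁻¹
    rw [inv_mul_cancel₀ (Complex.Gamma_ne_zero_of_re_pos ha)] at h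
    refine h.congr fun x => ?_
    simp only [tricomiV]
    ring
  | succ N ih =>
    intro a b ha
    have ha1 : 0 < (a + 1).re + N := by
      push_cast at ha
      simp only [Complex.add_re, Complex.one_re]
      linarith
    have hinv : Tendsto (fun x : ℝ => ((x : ℂ))⁻¹) atTop (𝓝 0) := by
      have := (Complex.continuous_ofReal.tendsto 0).comp tendsto_inv_atTop_zero
      simpa [Function.comp_def] using this
    have h := (ih (a + 1) (b + 1) ha1).sub
      ((hinv.mul (ih (a + 1) b ha1)).const_mul (b - a - 1))
    rw [zero_mul, mul_zero, sub_zero] at h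
    refine h.congr' ?_
    filter_upwards [eventually_gt_atTop 0] with x hx
    have hx0 : (x : ℂ) ≠ 0 := by exact_mod_cast hx.ne'
    rw [cpow_add_one hx0]
    simp only [tricomiV]
    field_simp

theorem tricomiV_conj (N : ℕ) : ∀ (a b : ℂ) (x : ℝ),
    tricomiV N (conj a) (conj b) x = conj (tricomiV N a b x) := by
  induction N with
  | zero =>
    intro a b x
    simp only [tricomiV, map_mul, map_inv₀]
    rw [← conj_laplaceI, ← Complex.Gamma_conj]
    simp
  | succ N ih =>
    intro a b x
    simp only [tricomiV, map_mul, map_sub, map_one, ← ih, map_add, Complex.conj_ofReal]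

/-- The function `e^(-xs) (1+s)^c`. -/
def expPow (x : ℝ) (c : ℂ) (s : ℝ) : ℂ := Complex.exp (-(x * s)) * ((1 + s : ℝ) : ℂ) ^ c

theorem contDiffOn_expPow (x : ℝ) (c : ℂ) (N : ℕ) : ContDiffOn ℝ N (expPow x c) (Ioi 0) := by
  intro t ht
  have ht' : (0 : ℝ) < t := ht
  refine ContDiffAt.contDiffWithinAt ?_
  unfold expPow
  have h1 : ContDiffAt ℝ N (fun s : ℝ => (s : ℂ)) t := Complex.ofRealCLM.contDiff.contDiffAt
  have h2 : ContDiffAt ℝ N (fun s : ℝ => ((1 + s : ℝ) : ℂ)) t := by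
    simp only [Complex.ofReal_add]
    exact contDiffAt_const.add h1
  refine ContDiffAt.mul ((contDiffAt_const.mul h1).neg.cexp) ?_
  have h3 : ContDiffAt ℂ N (fun z : ℂ => z ^ c) ((1 + t : ℝ) : ℂ) := by
    refine AnalyticAt.contDiffAt ?_
    refine AnalyticAt.cpow analyticAt_id analyticAt_const (Or.inl ?_)
    simp
    linarith
  exact (h3.restrict_scalars ℝ).comp t h2

theorem iteratedDeriv_expPow_succ (N : ℕ) (x : ℝ) (c : ℂ) {t : ℝ} (ht : 0 < t) :
    iteratedDeriv (N + 1) (expPow x c) t =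
      -x * iteratedDeriv N (expPow x c) t + c * iteratedDeriv N (expPow x (c - 1)) t := by
  rw [iteratedDeriv_succ']
  have hd : EqOn (deriv (expPow x c)) ((-x : ℂ) • expPow x c + c • expPow x (c - 1)) (Ioi 0) := by
    intro s hs
    have hs' : (0 : ℝ) < s := hs
    have h3 : HasDerivAt (fun y : ℝ => Complex.exp (-(x * y)))
        (Complex.exp (-(x * s)) * (-(x * 1))) s :=
      (((Complex.ofRealCLM.hasDerivAt (x := s)).const_mul (x : ℂ)).neg).cexp
    have h4 : HasDerivAt (expPow x c) _ s := h3.mul (hasDerivAt_one_add_cpow c (by linarith))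
    rw [h4.deriv]
    simp only [expPow, Pi.add_apply, Pi.smul_apply, smul_eq_mul]
    ring
  rw [hd.iteratedDeriv_of_isOpen isOpen_Ioi N ht]
  have hc : ∀ c, ContDiffAt ℝ N (expPow x c) t := fun c =>
    (contDiffOn_expPow x c N).contDiffAt (Ioi_mem_nhds ht)
  have h1 : ContDiffAt ℝ N ((-x : ℂ) • expPow x c) t := (hc c).const_smul (-x : ℂ)
  have h2 : ContDiffAt ℝ N (c • expPow x (c - 1)) t := (hc (c - 1)).const_smul c
  rw [iteratedDeriv_add h1 h2, iteratedDeriv_const_smul_field, iteratedDeriv_const_smul_field]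
  rfl

/-- With `A = a + N` and `c = b - a - 1`, one more derivative of `e^(-xs) (1+s)^c` produces `-x`
times the same function and `c` times the one with exponent `c - 1`. This is the recursion of
`tricomiV`: passing to `(a+1, b+1)` keeps `c`, passing to `(a+1, b)` lowers it by one. No boundary
terms have to be examined here. -/
theorem integral_iteratedDeriv_expPow (N : ℕ) : ∀ (A c : ℂ) (x : ℝ), 0 < A.re → 0 < x →
    IntegrableOn (fun t : ℝ => (t : ℂ) ^ (A - 1) * iteratedDeriv N (expPow x c) t) (Ioi 0) ∧
    (-1) ^ N / Complex.Gamma A *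
      ∫ t in Ioi (0 : ℝ), (t : ℂ) ^ (A - 1) * iteratedDeriv N (expPow x c) t =
      tricomiV N (A - N) (c + (A - N) + 1) x := by
  induction N with
  | zero =>
    intro A c x hA hx
    simp only [iteratedDeriv_zero, pow_zero, Nat.cast_zero, sub_zero, tricomiV]
    have e : c + A + 1 - A - 1 = c := by ring
    rw [e, one_div]
    exact ⟨integrableOn_laplaceKernel c hA hx, rfl⟩
  | succ N ih =>
    intro A c x hA hx
    obtain ⟨i1, h1⟩ := ih A c x hA hx
    obtain ⟨i2, h2⟩ := ih A (c - 1) x hA hx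
    have heq : EqOn (fun t : ℝ => (t : ℂ) ^ (A - 1) * iteratedDeriv (N + 1) (expPow x c) t)
        (fun t : ℝ => (-x : ℂ) * ((t : ℂ) ^ (A - 1) * iteratedDeriv N (expPow x c) t) +
          c * ((t : ℂ) ^ (A - 1) * iteratedDeriv N (expPow x (c - 1)) t)) (Ioi 0) := by
      intro t ht
      simp only
      rw [iteratedDeriv_expPow_succ N x c ht]
      ring
    have j1 := i1.const_mul (-x : ℂ)
    have j2 := i2.const_mul c
    refine ⟨(integrableOn_congr_fun heq measurableSet_Ioi).2 (j1.add j2), ?_⟩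
    rw [setIntegral_congr_fun measurableSet_Ioi heq, integral_add j1 j2, integral_const_mul,
      integral_const_mul]
    simp only [tricomiV]
    have e1 : A - ((N + 1 : ℕ) : ℂ) + 1 = A - N := by push_cast; ring
    have e2 : c + (A - ((N + 1 : ℕ) : ℂ)) + 1 + 1 = c + (A - N) + 1 := by push_cast; ring
    have e3 : c + (A - ((N + 1 : ℕ) : ℂ)) + 1 = c - 1 + (A - N) + 1 := by push_cast; ring
    have e4 : c + (A - ((N + 1 : ℕ) : ℂ)) + 1 - (A - ((N + 1 : ℕ) : ℂ)) - 1 = c := by ring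
    rw [e4, e1, e2, e3, ← h1, ← h2]
    ring

/-- The number of integrations by parts in the definition of `tricomiU`. -/
def tricomiOrder (a : ℂ) : ℕ := (⌊-a.re⌋ + 1).toNat

theorem re_add_tricomiOrder_pos (a : ℂ) : 0 < a.re + tricomiOrder a := by
  have h1 : (⌊-a.re⌋ + 1 : ℤ) ≤ (tricomiOrder a : ℤ) := Int.self_le_toNat _
  have h2 : ((⌊-a.re⌋ : ℝ) + 1) ≤ (tricomiOrder a : ℝ) := by exact_mod_cast h1
  linarith [Int.lt_floor_add_one (-a.re)]

theorem tricomiU_eq_tricomiV (a b : ℂ) {x : ℝ} (hx : 0 < x) :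
    tricomiU a b x = tricomiV (tricomiOrder a) a b x := by
  have hA : 0 < (a + tricomiOrder a).re := by
    simpa using re_add_tricomiOrder_pos a
  have h := (integral_iteratedDeriv_expPow (tricomiOrder a) (a + tricomiOrder a) (b - a - 1) x
    hA hx).2
  have e1 : b - a - 1 + a + 1 = b := by ring
  rw [add_sub_cancel_right, e1] at h
  exact h

end TricomiContinuation

/-! ### The radial solutions `F` and `G`: equation, behaviour at the ends, conjugation -/

section RadialSolutions

/-- `f` is a twice differentiable solution of `f'' = P f` on `(0,∞)`. -/
structure IsRadialSol (P : ℝ → ℂ) (f : ℝ → ℂ) : Prop where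
  hasDerivAt : ∀ r, 0 < r → HasDerivAt f (deriv f r) r
  hasDerivAt_deriv : ∀ r, 0 < r → HasDerivAt (deriv f) (P r * f r) r

theorem IsRadialSol.of_hasDerivAt {P f f' : ℝ → ℂ} (h1 : ∀ r, 0 < r → HasDerivAt f (f' r) r)
    (h2 : ∀ r, 0 < r → HasDerivAt f' (P r * f r) r) : IsRadialSol P f where
  hasDerivAt r hr := (h1 r hr).differentiableAt.hasDerivAt
  hasDerivAt_deriv r hr := (h2 r hr).congr_of_eventuallyEq <| by
    filter_upwards [Ioi_mem_nhds hr] with s hs using (h1 s hs).deriv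

/-- The coefficient `V - k` of the radial equation `f'' = (V - k) f`. -/
def radialCoeff (B : ℝ) (i : Fin 2) (n : ℤ) (k : ℂ) (r : ℝ) : ℂ := (potential B i n r : ℂ) - k

theorem continuousOn_radialCoeff (B : ℝ) (i : Fin 2) (n : ℤ) (k : ℂ) :
    ContinuousOn (radialCoeff B i n k) (Ioi 0) := by
  have h : ContinuousOn (potential B i n) (Ioi 0) := by
    intro r hr
    have hr' : (0 : ℝ) < r := hr
    have h1 : r ≠ 0 := hr'.ne'
    have h2 : 4 * r ^ 2 ≠ 0 := by positivity
    refine ContinuousAt.continuousWithinAt ?_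
    unfold potential
    fun_prop (disch := assumption)
  exact (Complex.continuous_ofReal.comp_continuousOn h).sub continuousOn_const

theorem hasDerivAt_radialWeight (B : ℝ) (n : ℤ) {r : ℝ} (hr : 0 < r) :
    HasDerivAt (radialWeight B n)
      (((1 / 2 + |(n : ℝ)|) / r - B / 2 * r : ℝ) * radialWeight B n r) r := by
  have h1 := (hasDerivAt_id r).rpow_const (p := 1 / 2 + |(n : ℝ)|) (Or.inl hr.ne')
  have h2 : HasDerivAt (fun y : ℝ => Real.exp (-(B * y ^ 2 / 4)))
      (Real.exp (-(B * r ^ 2 / 4)) * (-(B * (2 * r) / 4))) r := by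
    have := (((hasDerivAt_pow 2 r).const_mul B).div_const 4).neg.exp
    simpa using this
  have h3 := (h1.mul h2).ofReal_comp
  refine h3.congr_deriv ?_
  rw [radialWeight, ← Complex.ofReal_mul, id, Real.rpow_sub_one hr.ne']
  congr 1
  field_simp
  ring

theorem continuous_radialWeight (B : ℝ) (n : ℤ) : Continuous (radialWeight B n) := by
  unfold radialWeight
  have h : Continuous fun r : ℝ => r ^ (1 / 2 + |(n : ℝ)|) :=
    Real.continuous_rpow_const (by positivity)
  fun_prop

theorem radialWeight_ne_zero (B : ℝ) (n : ℤ) {r : ℝ} (hr : 0 < r) : radialWeight B n r ≠ 0 := by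
  rw [radialWeight, Complex.ofReal_ne_zero]
  positivity

/-- The substitution `x = B r²/2` together with the weight reduces the radial equation to Kummer's
equation; stated for an arbitrary solution `w`, it serves both `F` and `G`. -/
theorem isRadialSol_radialWeight_mul {B : ℝ} (hB : 0 < B) (i : Fin 2) (n : ℤ) (k : ℂ)
    {w w1 w2 : ℝ → ℂ} (h1 : ∀ x, 0 < x → HasDerivAt w (w1 x) x)
    (h2 : ∀ x, 0 < x → HasDerivAt w1 (w2 x) x)
    (hode : ∀ x : ℝ, 0 < x →
      x * w2 x + ((|(n : ℝ)| + 1 : ℝ) - x) * w1 x - kummerParam B i n k * w x = 0) :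
    IsRadialSol (radialCoeff B i n k) fun r => radialWeight B n r * w (B / 2 * r ^ 2) := by
  have hx : ∀ {r : ℝ}, 0 < r → 0 < B / 2 * r ^ 2 := fun hr => by positivity
  have hin : ∀ r : ℝ, HasDerivAt (fun y : ℝ => B / 2 * y ^ 2) (B * r) r := fun r => by
    have := (hasDerivAt_pow 2 r).const_mul (B / 2)
    refine this.congr_deriv ?_
    push_cast
    ring
  have d1 : ∀ r, 0 < r → HasDerivAt (fun y : ℝ => w (B / 2 * y ^ 2))
      ((B * r : ℝ) * w1 (B / 2 * r ^ 2)) r := fun r hr => by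
    have := (h1 _ (hx hr)).scomp r (hin r)
    exact this
  have d2 : ∀ r, 0 < r → HasDerivAt (fun y : ℝ => w1 (B / 2 * y ^ 2))
      ((B * r : ℝ) * w2 (B / 2 * r ^ 2)) r := fun r hr => by
    have := (h2 _ (hx hr)).scomp r (hin r)
    exact this
  refine IsRadialSol.of_hasDerivAt (fun r hr => (hasDerivAt_radialWeight B n hr).mul (d1 r hr))
    fun r hr => ?_
  have hr0 : (r : ℂ) ≠ 0 := by exact_mod_cast hr.ne'
  have hB0 : (B : ℂ) ≠ 0 := by exact_mod_cast hB.ne'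
  have e1 : HasDerivAt (fun y : ℝ => (((1 / 2 + |(n : ℝ)|) / y - B / 2 * y : ℝ) : ℂ))
      ((-(1 / 2 + |(n : ℝ)|) / r ^ 2 - B / 2 : ℝ) : ℂ) r := by
    have h3 : HasDerivAt (fun y : ℝ => (1 / 2 + |(n : ℝ)|) / y - B / 2 * y)
        (-(1 / 2 + |(n : ℝ)|) / r ^ 2 - B / 2) r := by
      have := ((hasDerivAt_inv hr.ne').const_mul (1 / 2 + |(n : ℝ)|)).sub
        ((hasDerivAt_id r).const_mul (B / 2))
      refine this.congr_deriv ?_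
      field_simp
    exact h3.ofReal_comp
  have e2 : HasDerivAt (fun y : ℝ => ((B * y : ℝ) : ℂ)) (B : ℂ) r := by
    have := ((hasDerivAt_id r).const_mul B).ofReal_comp
    simpa using this
  have hW := hasDerivAt_radialWeight B n hr
  have key := ((e1.mul hW).mul (d1 r hr)).add (hW.mul (e2.mul (d2 r hr)))
  refine key.congr_deriv ?_
  have ho := hode _ (hx hr)
  -- The weight involves `|n|` and the potential `n²`; this is the only relation between `|n|` and
  -- `n` that the computation uses.
  have habs : ((|(n : ℝ)| : ℝ) : ℂ) ^ 2 = (n : ℂ) ^ 2 := by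
    rw [← Complex.ofReal_pow, sq_abs]
    push_cast
    rfl
  simp only [Pi.mul_apply]
  rw [radialCoeff, potential]
  rw [kummerParam] at ho
  push_cast at ho ⊢
  generalize w (B / 2 * r ^ 2) = A0 at ho ⊢
  generalize w1 (B / 2 * r ^ 2) = A1 at ho ⊢
  generalize w2 (B / 2 * r ^ 2) = A2 at ho ⊢
  generalize radialWeight B n r = W at ho ⊢
  generalize ((|(n : ℝ)| : ℝ) : ℂ) = ν at ho habs ⊢
  field_simp at ho ⊢
  linear_combination (W * 16 * r ^ 2) * ho + W * A0 * 16 * habs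

theorem abs_intCast_add_one_ne_zero (n : ℤ) : ((|(n : ℝ)| + 1 : ℝ) : ℂ) ≠ 0 := by
  rw [Complex.ofReal_ne_zero]
  positivity

theorem isRadialSol_solF {B : ℝ} (hB : 0 < B) (i : Fin 2) (n : ℤ) (k : ℂ) :
    IsRadialSol (radialCoeff B i n k) (solF B i n k) := by
  set a := kummerParam B i n k with ha
  set b : ℂ := ((|(n : ℝ)| + 1 : ℝ) : ℂ) with hb
  have hb0 : b ≠ 0 := abs_intCast_add_one_ne_zero n
  have hb1 : b + 1 ≠ 0 := by
    rw [hb, ← Complex.ofReal_one, ← Complex.ofReal_add, Complex.ofReal_ne_zero]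
    positivity
  exact isRadialSol_radialWeight_mul hB i n k (w := fun x => kummerM a b x)
    (w1 := fun x => a / b * kummerM (a + 1) (b + 1) x)
    (w2 := fun x => a / b * ((a + 1) / (b + 1) * kummerM (a + 1 + 1) (b + 1 + 1) x))
    (fun x _ => (kummerM_hasDerivAt a b x hb0).comp_ofReal)
    (fun x _ => ((kummerM_hasDerivAt (a + 1) (b + 1) x hb1).comp_ofReal).const_mul _)
    fun x _ => kummerM_ode a b x hb0 hb1

theorem continuous_kummerM_ofReal (B : ℝ) (i : Fin 2) (n : ℤ) (k : ℂ) : Continuous fun r : ℝ =>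
    kummerM (kummerParam B i n k) (|(n : ℝ)| + 1 : ℝ) (B / 2 * r ^ 2 : ℝ) := by
  have h : Continuous (kummerM (kummerParam B i n k) (|(n : ℝ)| + 1 : ℝ)) :=
    continuous_iff_continuousAt.2 fun z =>
      (kummerM_hasDerivAt _ _ z (abs_intCast_add_one_ne_zero n)).continuousAt
  exact h.comp (by fun_prop)

theorem continuous_solF (B : ℝ) (i : Fin 2) (n : ℤ) (k : ℂ) : Continuous (solF B i n k) :=
  (continuous_radialWeight B n).mul (continuous_kummerM_ofReal B i n k)

theorem memLp_solF (B : ℝ) (i : Fin 2) (n : ℤ) (k : ℂ) (b : ℝ) :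
    MemLp (solF B i n k) 2 (volume.restrict (Ioo 0 b)) := by
  obtain ⟨C, hC⟩ := (isCompact_Icc (a := (0 : ℝ)) (b := b)).exists_bound_of_continuousOn
    (continuous_solF B i n k).continuousOn
  refine MemLp.of_bound (continuous_solF B i n k).aestronglyMeasurable C ?_
  filter_upwards [ae_restrict_mem measurableSet_Ioo] with r hr
  exact hC r (Ioo_subset_Icc_self hr)

theorem eventually_solF_ne_zero (B : ℝ) (i : Fin 2) (n : ℤ) (k : ℂ) :
    ∀ᶠ r in 𝓝[>] 0, solF B i n k r ≠ 0 := by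
  have h := (continuous_kummerM_ofReal B i n k).tendsto 0
  have h0 : kummerM (kummerParam B i n k) (|(n : ℝ)| + 1 : ℝ) (B / 2 * 0 ^ 2 : ℝ) = 1 := by
    have : ((B / 2 * 0 ^ 2 : ℝ) : ℂ) = 0 := by simp
    rw [this]
    refine kummerM_zero _ _ (Complex.Gamma_ne_zero_of_re_pos ?_)
    rw [Complex.ofReal_re]
    positivity
  rw [h0] at h
  filter_upwards [(h.eventually_ne one_ne_zero).filter_mono nhdsWithin_le_nhds,
    self_mem_nhdsWithin] with r h1 h2
  exact mul_ne_zero (radialWeight_ne_zero B n h2) h1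

/-- For `n = 0` the quotient `F / √r` has a finite limit at `0`, so division by `ln r` sends it to
zero. -/
theorem originCondition_solF (B : ℝ) (i : Fin 2) (n : ℤ) (k : ℂ) :
    OriginCondition n (solF B i n k) := by
  rintro rfl
  have h1 : Tendsto (fun r : ℝ => Complex.exp (-(B * r ^ 2 / 4)) *
      kummerM (kummerParam B i 0 k) (|((0 : ℤ) : ℝ)| + 1 : ℝ) (B / 2 * r ^ 2 : ℝ)) (𝓝[>] 0)
      (𝓝 (Complex.exp (-(B * (0 : ℝ) ^ 2 / 4)) *
      kummerM (kummerParam B i 0 k) (|((0 : ℤ) : ℝ)| + 1 : ℝ) (B / 2 * 0 ^ 2 : ℝ))) := by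
    have hc : Continuous fun r : ℝ => Complex.exp (-(B * r ^ 2 / 4)) *
      kummerM (kummerParam B i 0 k) (|((0 : ℤ) : ℝ)| + 1 : ℝ) (B / 2 * r ^ 2 : ℝ) := by
      refine Continuous.mul (by fun_prop) (continuous_kummerM_ofReal B i 0 k)
    exact (hc.tendsto 0).mono_left nhdsWithin_le_nhds
  have h2 : Tendsto (fun r : ℝ => ((Real.log r : ℝ) : ℂ)⁻¹) (𝓝[>] 0) (𝓝 0) := by
    have := (Complex.continuous_ofReal.tendsto 0).comp
      Real.tendsto_log_nhdsGT_zero.inv_tendsto_atBot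
    simpa [Function.comp_def] using this
  have h3 := h1.mul h2
  rw [mul_zero] at h3
  refine h3.congr' ?_
  filter_upwards [self_mem_nhdsWithin] with r hr
  have hr' : (0 : ℝ) < r := hr
  have hs : ((√r : ℝ) : ℂ) ≠ 0 := by
    rw [Complex.ofReal_ne_zero]
    positivity
  rw [solF, radialWeight]
  simp only [Int.cast_zero, abs_zero, add_zero]
  rw [← Real.sqrt_eq_rpow]
  push_cast
  field_simp

theorem isRadialSol_solG {B : ℝ} (hB : 0 < B) (i : Fin 2) (n : ℤ) (k : ℂ) :
    IsRadialSol (radialCoeff B i n k) (solG B i n k) := by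
  set a := kummerParam B i n k with ha
  set b : ℂ := ((|(n : ℝ)| + 1 : ℝ) : ℂ) with hb
  set N := tricomiOrder a
  have h0 : 0 < a.re + N := re_add_tricomiOrder_pos a
  have h1 : 0 < (a + 1).re + N := by
    simp only [Complex.add_re, Complex.one_re]
    linarith
  have hU : ∀ x : ℝ, 0 < x → tricomiU a b =ᶠ[𝓝 x] tricomiV N a b := fun x hx => by
    filter_upwards [Ioi_mem_nhds hx] with y hy using tricomiU_eq_tricomiV a b hy
  refine isRadialSol_radialWeight_mul hB i n k (w := tricomiU a b)
    (w1 := fun x => -a * tricomiV N (a + 1) (b + 1) x)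
    (w2 := fun x => -a * (-(a + 1) * tricomiV N (a + 1 + 1) (b + 1 + 1) x))
    (fun x hx => (hasDerivAt_tricomiV N a b h0 hx).congr_of_eventuallyEq (hU x hx))
    (fun x hx => (hasDerivAt_tricomiV N (a + 1) (b + 1) h1 hx).const_mul _)
    fun x hx => ?_
  have := tricomiV_ode N a b h0 hx
  rw [tricomiU_eq_tricomiV a b hx]
  linear_combination this

/-- This asymptotic serves twice: it gives the decay of `G` and shows that `G` has no zeros near
infinity. -/
theorem tendsto_solG {B : ℝ} (hB : 0 < B) (i : Fin 2) (n : ℤ) (k : ℂ) :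
    Tendsto (fun r : ℝ => ((B / 2 * r ^ 2 : ℝ) : ℂ) ^ kummerParam B i n k *
      tricomiU (kummerParam B i n k) (|(n : ℝ)| + 1 : ℝ) (B / 2 * r ^ 2)) atTop (𝓝 1) := by
  have hx : Tendsto (fun r : ℝ => B / 2 * r ^ 2) atTop atTop :=
    (tendsto_pow_atTop two_ne_zero).const_mul_atTop (by positivity)
  have h := (tendsto_tricomiV (tricomiOrder (kummerParam B i n k)) (kummerParam B i n k)
    (|(n : ℝ)| + 1 : ℝ) (re_add_tricomiOrder_pos _)).comp hx
  refine h.congr' ?_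
  filter_upwards [eventually_gt_atTop 0] with r hr
  rw [tricomiU_eq_tricomiV _ _ (by positivity)]
  rfl

theorem eventually_solG_ne_zero {B : ℝ} (hB : 0 < B) (i : Fin 2) (n : ℤ) (k : ℂ) :
    ∀ᶠ r in atTop, solG B i n k r ≠ 0 := by
  filter_upwards [(tendsto_solG hB i n k).eventually_ne one_ne_zero, eventually_gt_atTop 0]
    with r h1 h2
  exact mul_ne_zero (radialWeight_ne_zero B n h2) (right_ne_zero_of_mul h1)

theorem solG_isBigO {B : ℝ} (hB : 0 < B) (i : Fin 2) (n : ℤ) (k : ℂ) :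
    solG B i n k =O[atTop] fun r : ℝ => Real.exp (-(1 / 2) * r) := by
  set a := kummerParam B i n k with ha
  set p : ℝ := 1 / 2 + |(n : ℝ)| with hp
  have h1 := rpow_mul_exp_neg_mul_sq_isLittleO_exp_neg (b := B / 4) (by positivity)
    (p - 2 * a.re)
  refine Asymptotics.IsBigO.trans ?_ h1.isBigO
  -- The `2` bounds the norm of `x^a U`, whose limit has norm `1`; the power of `B/2` comes from `x
  -- = B r²/2` in `x^(-Re a)`.
  refine Asymptotics.IsBigO.of_bound (2 * (B / 2) ^ (-a.re)) ?_
  filter_upwards [(tendsto_solG hB i n k).norm.eventually_le_const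
    (show ‖(1 : ℂ)‖ < 2 by norm_num), eventually_gt_atTop 0] with r h2 hr
  have hx : 0 < B / 2 * r ^ 2 := by positivity
  rw [norm_mul, Complex.norm_cpow_eq_rpow_re_of_pos hx, ← ha] at h2
  have h3 : ‖tricomiU a (|(n : ℝ)| + 1 : ℝ) (B / 2 * r ^ 2)‖ ≤ 2 * (B / 2 * r ^ 2) ^ (-a.re) := by
    rw [Real.rpow_neg hx.le, ← div_eq_mul_inv, le_div_iff₀ (by positivity), mul_comm]
    exact h2
  have h4 : (B / 2 * r ^ 2) ^ (-a.re) = (B / 2) ^ (-a.re) * r ^ (-(2 * a.re)) := by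
    rw [Real.mul_rpow (by positivity) (by positivity), ← Real.rpow_natCast, ← Real.rpow_mul hr.le]
    congr 2
    push_cast
    ring
  rw [solG, norm_mul, radialWeight, Complex.norm_real, Real.norm_of_nonneg (by positivity),
    Real.norm_of_nonneg (by positivity), ← hp, ← ha]
  calc r ^ p * Real.exp (-(B * r ^ 2 / 4)) * ‖tricomiU a (|(n : ℝ)| + 1 : ℝ) (B / 2 * r ^ 2)‖
      ≤ r ^ p * Real.exp (-(B * r ^ 2 / 4)) * (2 * (B / 2 * r ^ 2) ^ (-a.re)) := by gcongr
    _ = 2 * (B / 2) ^ (-a.re) * (r ^ p * r ^ (-(2 * a.re)) * Real.exp (-(B / 4) * r ^ 2)) := by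
        rw [h4]
        ring_nf
    _ = _ := by rw [← Real.rpow_add hr, sub_eq_add_neg]

theorem IsRadialSol.continuousOn {P f : ℝ → ℂ} (h : IsRadialSol P f) : ContinuousOn f (Ioi 0) :=
  fun r hr => (h.hasDerivAt r hr).continuousAt.continuousWithinAt

theorem memLp_solG {B : ℝ} (hB : 0 < B) (i : Fin 2) (n : ℤ) (k : ℂ) {a : ℝ} (ha : 0 < a) :
    MemLp (solG B i n k) 2 (volume.restrict (Ioi a)) := by
  have hc : ContinuousOn (solG B i n k) (Ioi 0) := (isRadialSol_solG hB i n k).continuousOn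
  have hc' : ContinuousOn (solG B i n k) (Ioi a) := hc.mono (Ioi_subset_Ioi ha.le)
  rw [memLp_two_iff_integrable_sq_norm (hc'.aestronglyMeasurable measurableSet_Ioi)]
  refine integrable_of_isBigO_exp_neg (b := 1) one_pos
    ((hc.mono fun r hr => ha.trans_le hr).norm.pow 2) ?_
  refine ((solG_isBigO hB i n k).norm_left.pow 2).congr_right fun r => ?_
  rw [← Real.exp_nat_mul]
  congr 1
  push_cast
  ring

theorem kummerParam_conj (B : ℝ) (i : Fin 2) (n : ℤ) (k : ℂ) :
    kummerParam B i n (conj k) = conj (kummerParam B i n k) := by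
  simp [kummerParam, map_ofNat]

theorem solF_conj (B : ℝ) (i : Fin 2) (n : ℤ) (k : ℂ) (r : ℝ) :
    solF B i n (conj k) r = conj (solF B i n k r) := by
  rw [solF, solF, map_mul, ← kummerM_conj, kummerParam_conj, Complex.conj_ofReal,
    Complex.conj_ofReal, radialWeight, Complex.conj_ofReal]

theorem solG_conj {B : ℝ} (hB : 0 < B) (i : Fin 2) (n : ℤ) (k : ℂ) {r : ℝ} (hr : 0 < r) :
    solG B i n (conj k) r = conj (solG B i n k r) := by
  have hx : 0 < B / 2 * r ^ 2 := by positivity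
  rw [solG, solG, map_mul, kummerParam_conj, tricomiU_eq_tricomiV _ _ hx,
    tricomiU_eq_tricomiV _ _ hx, ← tricomiV_conj, Complex.conj_ofReal, radialWeight,
    Complex.conj_ofReal, tricomiOrder, tricomiOrder, Complex.conj_re]

theorem deriv_conj_of_forall_pos {f g : ℝ → ℂ} (h : ∀ r, 0 < r → f r = conj (g r)) {r : ℝ}
    (hr : 0 < r) : deriv f r = conj (deriv g r) := by
  have h1 : f =ᶠ[𝓝 r] fun s => star (g s) := by
    filter_upwards [Ioi_mem_nhds hr] with s hs using h s hs
  rw [h1.deriv_eq, deriv.star]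
  rfl

/-- The equation and its parameters are real apart from `k`. This is why `φ(k̄)` stands in the
antilinear slot of the resolvent formula. -/
theorem phi_conj {B R : ℝ} (hB : 0 < B) (hR : 0 < R) (i : Fin 2) (n : ℤ) (k : ℂ) {r : ℝ}
    (hr : 0 < r) : phi B R i n (conj k) r = conj (phi B R i n k r) := by
  have hF := fun (r : ℝ) (_ : 0 < r) => solF_conj B i n k r
  have hG := fun (r : ℝ) (hr : 0 < r) => solG_conj hB i n k hr
  have hF' := deriv_conj_of_forall_pos hF hR
  have hG' := deriv_conj_of_forall_pos hG hR
  have hM : normM B R i n (conj k) = conj (normM B R i n k) := by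
    rw [normM, normM, wronskian, wronskian, hF', hG', hF R hR, hG R hR]
    simp
  rw [phi, phi, hM, hF', hG', hF r hr, hG r hr]
  split_ifs <;> simp

end RadialSolutions

/-! ### Square integrability and density of test functions -/

section SquareIntegrable

theorem toRadialL2_of_memLp {f : ℝ → ℂ} (h : MemLp f 2 (volume.restrict (Ioi (0 : ℝ)))) :
    toRadialL2 f = h.toLp f := dif_pos h

theorem coeFn_toRadialL2 {f : ℝ → ℂ} (h : MemLp f 2 (volume.restrict (Ioi (0 : ℝ)))) :
    toRadialL2 f =ᵐ[volume.restrict (Ioi (0 : ℝ))] f := by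
  rw [toRadialL2_of_memLp h]
  exact h.coeFn_toLp

theorem inner_toRadialL2 {f : ℝ → ℂ} (h : MemLp f 2 (volume.restrict (Ioi (0 : ℝ))))
    (v : RadialL2) : ⟪toRadialL2 f, v⟫_ℂ = ∫ r in Ioi (0 : ℝ), conj (f r) * v r := by
  rw [L2.inner_def]
  refine integral_congr_ae ?_
  filter_upwards [coeFn_toRadialL2 h] with r hr
  rw [hr, RCLike.inner_apply, mul_comm]

theorem integrable_mul_radialL2 {f : ℝ → ℂ} (h : MemLp f 2 (volume.restrict (Ioi (0 : ℝ))))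
    (v : RadialL2) : IntegrableOn (fun r => f r * v r) (Ioi 0) :=
  h.integrable_mul (Lp.memLp v)

theorem memLp_Ioi_of_split {f g h : ℝ → ℂ} {c : ℝ}
    (hg : MemLp g 2 (volume.restrict (Ioo 0 c))) (hh : MemLp h 2 (volume.restrict (Ioi c)))
    (h1 : ∀ r, 0 < r → r < c → f r = g r) (h2 : ∀ r, c < r → f r = h r) :
    MemLp f 2 (volume.restrict (Ioi (0 : ℝ))) := by
  have hs := ((memLp_indicator_iff_restrict measurableSet_Ioo).2 hg).add
    ((memLp_indicator_iff_restrict measurableSet_Ioi).2 hh)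
  refine (hs.restrict (Ioi 0)).ae_eq ?_
  have hne : ∀ᵐ x : ℝ, x ≠ c := by simp [ae_iff, measure_singleton]
  filter_upwards [ae_restrict_of_ae hne, ae_restrict_mem measurableSet_Ioi] with r hr hr0
  have hr0' : (0 : ℝ) < r := hr0
  rcases lt_or_gt_of_ne hr with h | h
  · simp [h, hr0', h1 r hr0' h, h.le]
  · simp [h, h2 r h, h.le]

theorem memLp_of_eq_ends {u F G : ℝ → ℂ} {a b : ℝ} {c d : ℂ} (ha : 0 < a)
    (hu : ContinuousOn u (Ioi 0)) (hF : MemLp F 2 (volume.restrict (Ioo 0 a)))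
    (hG : MemLp G 2 (volume.restrict (Ioi b))) (h1 : ∀ r, 0 < r → r < a → u r = c * F r)
    (h2 : ∀ r, b < r → u r = d * G r) : MemLp u 2 (volume.restrict (Ioi (0 : ℝ))) := by
  have hmid : MemLp u 2 (volume.restrict (Icc a b)) := by
    have hc : ContinuousOn u (Icc a b) := hu.mono fun r hr => ha.trans_le hr.1
    obtain ⟨C, hC⟩ := isCompact_Icc.exists_bound_of_continuousOn hc
    refine MemLp.of_bound (hc.aestronglyMeasurable measurableSet_Icc) C ?_
    filter_upwards [ae_restrict_mem measurableSet_Icc] with r hr using hC r hr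
  have hs : MemLp (fun r => (Icc a b).indicator u r + (Ioi b).indicator (fun r => d * G r) r) 2
      (volume.restrict (Ioi a)) :=
    (((memLp_indicator_iff_restrict measurableSet_Icc).2 hmid).add
      ((memLp_indicator_iff_restrict measurableSet_Ioi).2 (hG.const_mul d))).restrict _
  refine memLp_Ioi_of_split (hF.const_mul c) hs h1 fun r hr => ?_
  by_cases h : r ≤ b
  · simp [h, hr.le]
  · simp [h, not_le.1 h, h2 r (not_le.1 h)]

/-- A vector orthogonal to `p` annihilates all smooth test functions on `(0,∞)` and hence vanishes
almost everywhere. Supports stay away from `0`, where `G` is not controlled. -/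
theorem submodule_eq_top_of_continuous {p : Submodule ℂ RadialL2}
    (hp : IsClosed (p : Set RadialL2))
    (h : ∀ f : ℝ → ℂ, Continuous f → HasCompactSupport f → tsupport f ⊆ Ioi 0 →
      toRadialL2 f ∈ p) : p = ⊤ := by
  have : CompleteSpace p := hp.completeSpace_coe
  rw [← Submodule.orthogonal_eq_bot_iff, Submodule.eq_bot_iff]
  intro v hv
  have hloc : LocallyIntegrableOn (v : ℝ → ℂ) (Ioi 0) (volume.restrict (Ioi (0 : ℝ))) :=
    ((Lp.memLp v).locallyIntegrable one_le_two).locallyIntegrableOn _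
  have h0 := isOpen_Ioi.ae_eq_zero_of_integral_contDiff_smul_eq_zero hloc fun g hg hgc hgs => by
    have hc : Continuous fun r => (g r : ℂ) := Complex.continuous_ofReal.comp hg.continuous
    have hcs : HasCompactSupport fun r => (g r : ℂ) :=
      hgc.comp_left (g := fun x : ℝ => (x : ℂ)) Complex.ofReal_zero
    have hts : tsupport (fun r => (g r : ℂ)) ⊆ Ioi 0 :=
      (closure_mono (Function.support_comp_subset (g := fun x : ℝ => (x : ℂ))
        Complex.ofReal_zero g)).trans hgs
    have h1 := Submodule.inner_right_of_mem_orthogonal (h _ hc hcs hts) hv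
    rw [inner_toRadialL2 ((hc.memLp_of_hasCompactSupport hcs).restrict _)] at h1
    rw [← h1]
    simp
  rw [Lp.eq_zero_iff_ae_eq_zero]
  filter_upwards [h0, ae_restrict_mem measurableSet_Ioi] with r h1 h2 using h1 h2

/-- A bounded operator on `L²((0,∞))` which is an integral operator on continuous functions of
compact support is this integral operator. -/
theorem ae_eq_inner_of_continuous (S : RadialL2 →L[ℂ] RadialL2) (g : ℝ → RadialL2)
    (h : ∀ f : ℝ → ℂ, Continuous f → HasCompactSupport f → tsupport f ⊆ Ioi 0 →
      ∀ᵐ r ∂(volume.restrict (Ioi (0 : ℝ))), S (toRadialL2 f) r = ⟪g r, toRadialL2 f⟫_ℂ)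
    (v : RadialL2) : ∀ᵐ r ∂(volume.restrict (Ioi (0 : ℝ))), S v r = ⟪g r, v⟫_ℂ := by
  let p : Submodule ℂ RadialL2 :=
    { carrier := {v | ∀ᵐ r ∂(volume.restrict (Ioi (0 : ℝ))), S v r = ⟪g r, v⟫_ℂ}
      add_mem' := by
        intro v w hv hw
        have := Lp.coeFn_add (S v) (S w)
        rw [← map_add] at this
        filter_upwards [hv, hw, this] with r h1 h2 h3
        rw [h3, Pi.add_apply, h1, h2, inner_add_right]
      zero_mem' := by
        have := Lp.coeFn_zero ℂ 2 (volume.restrict (Ioi (0 : ℝ)))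
        rw [← map_zero S] at this
        filter_upwards [this] with r h1
        rw [h1, Pi.zero_apply, inner_zero_right]
      smul_mem' := by
        intro c v hv
        have := Lp.coeFn_smul c (S v)
        rw [← map_smul] at this
        filter_upwards [hv, this] with r h1 h2
        rw [h2, Pi.smul_apply, h1, inner_smul_right, smul_eq_mul] }
  -- Evaluation at a point is not continuous on `L²`, but along a subsequence `S (x n)` converges
  -- almost everywhere, while the scalar products converge for every `r`.
  have hp : IsClosed (p : Set RadialL2) := by
    refine IsSeqClosed.isClosed fun x y hx hxy => ?_
    have h1 : Tendsto (fun n => S (x n)) atTop (𝓝 (S y)) := (S.continuous.tendsto y).comp hxy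
    obtain ⟨ns, hns, h2⟩ := (tendstoInMeasure_of_tendsto_Lp h1).exists_seq_tendsto_ae
    have hx' : ∀ n, ∀ᵐ r ∂(volume.restrict (Ioi (0 : ℝ))), S (x n) r = ⟪g r, x n⟫_ℂ := hx
    filter_upwards [h2, ae_all_iff.2 hx'] with r h3 h4
    refine tendsto_nhds_unique h3 ?_
    simp only [h4]
    exact (tendsto_const_nhds.inner hxy).comp hns.tendsto_atTop
  have : v ∈ p := by
    rw [submodule_eq_top_of_continuous hp h]
    exact Submodule.mem_top
  exact this

theorem continuousLinearMap_ext_of_continuous {S S' : RadialL2 →L[ℂ] RadialL2}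
    (h : ∀ f : ℝ → ℂ, Continuous f → HasCompactSupport f → tsupport f ⊆ Ioi 0 →
      S (toRadialL2 f) = S' (toRadialL2 f)) : S = S' := by
  have h1 : IsClosed ((LinearMap.eqLocus (S : RadialL2 →ₗ[ℂ] RadialL2)
      (S' : RadialL2 →ₗ[ℂ] RadialL2) : Submodule ℂ RadialL2) : Set RadialL2) :=
    isClosed_eq S.continuous S'.continuous
  ext1 v
  have : v ∈ LinearMap.eqLocus (S : RadialL2 →ₗ[ℂ] RadialL2) (S' : RadialL2 →ₗ[ℂ] RadialL2) := by
    rw [submodule_eq_top_of_continuous h1 h]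
    exact Submodule.mem_top
  exact this

end SquareIntegrable

/-! ### Gluing at `R` and nonvanishing of the brackets -/

section RadialResolvent

/-- `u` is a twice differentiable solution of `-u'' + P u = f` on `(0,∞)`. -/
structure IsInhomSol (P f : ℝ → ℂ) (u : ℝ → ℂ) : Prop where
  hasDerivAt : ∀ r, 0 < r → HasDerivAt u (deriv u r) r
  hasDerivAt_deriv : ∀ r, 0 < r → HasDerivAt (deriv u) (P r * u r - f r) r

theorem IsInhomSol.of_hasDerivAt {P f u u' : ℝ → ℂ} (h1 : ∀ r, 0 < r → HasDerivAt u (u' r) r)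
    (h2 : ∀ r, 0 < r → HasDerivAt u' (P r * u r - f r) r) : IsInhomSol P f u where
  hasDerivAt r hr := (h1 r hr).differentiableAt.hasDerivAt
  hasDerivAt_deriv r hr := (h2 r hr).congr_of_eventuallyEq <| by
    filter_upwards [Ioi_mem_nhds hr] with s hs using (h1 s hs).deriv

theorem IsInhomSol.add_const_mul {P f u F : ℝ → ℂ} (hu : IsInhomSol P f u)
    (hF : IsRadialSol P F) (c : ℂ) : IsInhomSol P f fun r => u r + c * F r :=
  IsInhomSol.of_hasDerivAt (u' := fun r => deriv u r + c * deriv F r)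
    (fun r hr => (hu.hasDerivAt r hr).add ((hF.hasDerivAt r hr).const_mul c)) fun r hr =>
    ((hu.hasDerivAt_deriv r hr).add ((hF.hasDerivAt_deriv r hr).const_mul c)).congr_deriv (by ring)

theorem IsInhomSol.deriv_add_const_mul {P f u F : ℝ → ℂ} (hu : IsInhomSol P f u)
    (hF : IsRadialSol P F) (c : ℂ) {r : ℝ} (hr : 0 < r) :
    deriv (fun r => u r + c * F r) r = deriv u r + c * deriv F r :=
  ((hu.hasDerivAt r hr).add ((hF.hasDerivAt r hr).const_mul c)).deriv

theorem isInhomSol_zero (P : ℝ → ℂ) : IsInhomSol P (fun _ => 0) fun _ => 0 :=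
  IsInhomSol.of_hasDerivAt (u' := fun _ => 0) (fun r _ => hasDerivAt_const r 0)
    fun r _ => (hasDerivAt_const r 0).congr_deriv (by simp)

/-- The function equal to `g` on `(-∞,R)` and to `h` on `[R,∞)`. -/
def glue (R : ℝ) (g h : ℝ → ℂ) (r : ℝ) : ℂ := if r < R then g r else h r

theorem glue_eventuallyEq_of_lt {R r : ℝ} (g h : ℝ → ℂ) (hr : r < R) : glue R g h =ᶠ[𝓝 r] g := by
  filter_upwards [Iio_mem_nhds hr] with s hs using if_pos hs

theorem glue_eventuallyEq_of_gt {R r : ℝ} (g h : ℝ → ℂ) (hr : R < r) : glue R g h =ᶠ[𝓝 r] h := by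
  filter_upwards [Ioi_mem_nhds hr] with s hs using if_neg (not_lt.2 (le_of_lt hs))

theorem hasDerivAt_glue {R r : ℝ} {g h g' h' : ℝ → ℂ} (hr : r ≠ R) (hg : HasDerivAt g (g' r) r)
    (hh : HasDerivAt h (h' r) r) : HasDerivAt (glue R g h) (glue R g' h' r) r := by
  rcases lt_or_gt_of_ne hr with h1 | h1
  · rw [(glue_eventuallyEq_of_lt g' h' h1).eq_of_nhds]
    exact hg.congr_of_eventuallyEq (glue_eventuallyEq_of_lt g h h1)
  · rw [(glue_eventuallyEq_of_gt g' h' h1).eq_of_nhds]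
    exact hh.congr_of_eventuallyEq (glue_eventuallyEq_of_gt g h h1)

theorem tendsto_glue_left {R : ℝ} {g : ℝ → ℂ} (h : ℝ → ℂ) (hg : ContinuousAt g R) :
    Tendsto (glue R g h) (𝓝[<] R) (𝓝 (g R)) := by
  refine (hg.tendsto.mono_left nhdsWithin_le_nhds).congr' ?_
  filter_upwards [self_mem_nhdsWithin] with s hs using (if_pos hs).symm

theorem tendsto_glue_right {R : ℝ} (g : ℝ → ℂ) {h : ℝ → ℂ} (hh : ContinuousAt h R) :
    Tendsto (glue R g h) (𝓝[>] R) (𝓝 (h R)) := by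
  refine (hh.tendsto.mono_left nhdsWithin_le_nhds).congr' ?_
  filter_upwards [self_mem_nhdsWithin] with s hs using (if_neg (not_lt.2 (le_of_lt hs))).symm

theorem isH2Loc_of_hasDerivAt {R : ℝ} {w w' w'' : ℝ → ℂ}
    (h1 : ∀ r, 0 < r → r ≠ R → HasDerivAt w (w' r) r)
    (h2 : ∀ r, 0 < r → r ≠ R → HasDerivAt w' (w'' r) r)
    (h3 : ∀ r, 0 < r → r ≠ R → ContinuousAt w'' r) : IsH2Loc R w w' w'' where
  hasDerivAt := h1
  memLp a b h0 hab hR := by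
    have hc : ContinuousOn w'' (Icc a b) := fun r hr =>
      (h3 r (h0.trans_le hr.1) fun h => hR (h ▸ hr)).continuousWithinAt
    obtain ⟨C, hC⟩ := isCompact_Icc.exists_bound_of_continuousOn hc
    refine MemLp.of_bound (hc.aestronglyMeasurable measurableSet_Icc) C ?_
    filter_upwards [ae_restrict_mem measurableSet_Icc] with r hr using hC r hr
  integral_eq a b h0 hab hR := by
    have hc : ContinuousOn w'' (uIcc a b) := fun r hr => by
      rw [uIcc_of_le hab] at hr
      exact (h3 r (h0.trans_le hr.1) fun h => hR (h ▸ hr)).continuousWithinAt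
    refine (intervalIntegral.integral_eq_sub_of_hasDerivAt (fun r hr => ?_)
      hc.intervalIntegrable).symm
    rw [uIcc_of_le hab] at hr
    exact h2 r (h0.trans_le hr.1) fun h => hR (h ▸ hr)

/-- Both pieces solve the equation on the whole half-line, so their one-sided limits at `R` are
plain values and the `δ'`-condition becomes two equations between numbers. -/
theorem glue_mem_graph {B R : ℝ} (hR : 0 < R) {i : Fin 2} {n : ℤ} {γ : ℝ} {k : ℂ}
    {f g h : ℝ → ℂ} (hf : Continuous f) (hfm : MemLp f 2 (volume.restrict (Ioi (0 : ℝ))))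
    (hg : IsInhomSol (radialCoeff B i n k) f g) (hh : IsInhomSol (radialCoeff B i n k) f h)
    (hm : MemLp (glue R g h) 2 (volume.restrict (Ioi (0 : ℝ)))) (hd : deriv g R = deriv h R)
    (hj : h R - g R = γ * deriv g R) (ho : OriginCondition n g) :
    (toRadialL2 (glue R g h), toRadialL2 f + k • toRadialL2 (glue R g h)) ∈
      (radialOp B R i n γ).graph := by
  rw [radialOp_graph]
  have hP := continuousOn_radialCoeff B i n k
  have hH : IsH2Loc R (glue R g h) (glue R (deriv g) (deriv h))
      (glue R (fun r => radialCoeff B i n k r * g r - f r)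
        (fun r => radialCoeff B i n k r * h r - f r)) := by
    refine isH2Loc_of_hasDerivAt
      (fun r hr hne => hasDerivAt_glue hne (hg.hasDerivAt r hr) (hh.hasDerivAt r hr))
      (fun r hr hne => hasDerivAt_glue hne (hg.hasDerivAt_deriv r hr) (hh.hasDerivAt_deriv r hr))
      fun r hr hne => ?_
    have hPr : ContinuousAt (radialCoeff B i n k) r := hP.continuousAt (Ioi_mem_nhds hr)
    rcases lt_or_gt_of_ne hne with h1 | h1
    · exact ((hPr.mul (hg.hasDerivAt r hr).continuousAt).sub hf.continuousAt).congr
        (glue_eventuallyEq_of_lt _ _ h1).symm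
    · exact ((hPr.mul (hh.hasDerivAt r hr).continuousAt).sub hf.continuousAt).congr
        (glue_eventuallyEq_of_gt _ _ h1).symm
  refine ⟨_, _, _, coeFn_toRadialL2 hm, hH, ⟨h R, g R, deriv g R,
    tendsto_glue_right _ (hh.hasDerivAt R hR).continuousAt,
    tendsto_glue_left _ (hg.hasDerivAt R hR).continuousAt, ?_,
    tendsto_glue_left _ (hg.hasDerivAt_deriv R hR).continuousAt, hj⟩, fun hn => ?_, ?_⟩
  · rw [hd]
    exact tendsto_glue_right _ (hh.hasDerivAt_deriv R hR).continuousAt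
  · refine (ho hn).congr' ?_
    filter_upwards [nhdsWithin_le_nhds (Iio_mem_nhds hR)] with r hr
    rw [glue, if_pos (show r < R from hr)]
  · filter_upwards [Lp.coeFn_add (toRadialL2 f) (k • toRadialL2 (glue R g h)),
      Lp.coeFn_smul k (toRadialL2 (glue R g h)), coeFn_toRadialL2 hm, coeFn_toRadialL2 hfm]
      with r a1 a2 a3 a4
    rw [a1, Pi.add_apply, a2, Pi.smul_apply, a3, a4, smul_eq_mul]
    simp only [glue, radialCoeff]
    split_ifs <;> ring

theorem memLp_glue_sol {B R : ℝ} (hB : 0 < B) (hR : 0 < R) (i : Fin 2) (n : ℤ) (k c d : ℂ) :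
    MemLp (glue R (fun r => c * solF B i n k r) fun r => d * solG B i n k r) 2
      (volume.restrict (Ioi (0 : ℝ))) := by
  refine memLp_Ioi_of_split ((memLp_solF B i n k R).const_mul c)
    ((memLp_solG hB i n k hR).const_mul d) (fun r _ hr => if_pos hr)
    fun r hr => if_neg (not_lt.2 hr.le)

theorem memLp_phi {B R : ℝ} (hB : 0 < B) (hR : 0 < R) (i : Fin 2) (n : ℤ) (k : ℂ) :
    MemLp (phi B R i n k) 2 (volume.restrict (Ioi (0 : ℝ))) :=
  memLp_glue_sol hB hR i n k _ _

theorem originCondition_const_mul_solF (B : ℝ) (i : Fin 2) (n : ℤ) (k c : ℂ) :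
    OriginCondition n fun r => c * solF B i n k r := by
  intro hn
  have := (originCondition_solF B i n k hn).const_mul c
  rw [mul_zero] at this
  exact this.congr fun r => by ring

theorem exists_ne_zero_of_det_eq_zero {a b c d : ℂ} (h : a * d - b * c = 0) :
    ∃ x y : ℂ, (x ≠ 0 ∨ y ≠ 0) ∧ a * x + b * y = 0 ∧ c * x + d * y = 0 := by
  by_cases h1 : a = 0 ∧ b = 0
  · by_cases h2 : c = 0 ∧ d = 0
    · exact ⟨1, 0, Or.inl one_ne_zero, by simp [h1.1], by simp [h2.1]⟩
    · refine ⟨d, -c, ?_, by simp [h1.1, h1.2], by ring⟩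
      by_contra hc
      push Not at hc
      exact h2 ⟨neg_eq_zero.1 hc.2, hc.1⟩
  · refine ⟨b, -a, ?_, by ring, by linear_combination -h⟩
    by_contra hc
    push Not at hc
    exact h1 ⟨neg_eq_zero.1 hc.2, hc.1⟩

/-- If the bracket vanished, some nontrivial `c F` on the left and `d G` on the right would satisfy
the boundary conditions and lie in the kernel of the operator minus `k`. That kernel is trivial, and
`F` has no zeros near `0` nor `G` near infinity, so `c = d = 0`. -/
theorem kreinDenom_ne_zero {B R : ℝ} (hB : 0 < B) (hR : 0 < R) {i : Fin 2} {n : ℤ} {γ : ℝ} {k : ℂ}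
    (hk : k ∈ opResolventSet (radialOp B R i n γ)) : kreinDenom B R i n γ k ≠ 0 := by
  intro h0
  have hF := isRadialSol_solF hB i n k
  have hG := isRadialSol_solG hB i n k
  -- The first row is continuity of the derivative at `R`, the second the jump condition; the
  -- determinant is minus the bracket.
  obtain ⟨c, d, hcd, h1, h2⟩ := exists_ne_zero_of_det_eq_zero (a := deriv (solF B i n k) R)
    (b := -deriv (solG B i n k) R) (c := solF B i n k R + γ * deriv (solF B i n k) R)
    (d := -solG B i n k R) (by rw [kreinDenom] at h0; linear_combination -h0)
  have hz := isInhomSol_zero (radialCoeff B i n k)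
  have hcF := hz.add_const_mul hF c
  have hdG := hz.add_const_mul hG d
  have ecF := hz.deriv_add_const_mul hF c hR
  have edG := hz.deriv_add_const_mul hG d hR
  simp only [zero_add, deriv_const] at hcF hdG ecF edG
  have hm := memLp_glue_sol hB hR i n k c d
  have hgr := glue_mem_graph hR (γ := γ) continuous_const MemLp.zero' hcF hdG hm
    (by rw [ecF, edG]; linear_combination h1) (by rw [ecF]; linear_combination -h2)
    (originCondition_const_mul_solF B i n k c)
  have hz0 : toRadialL2 (fun _ => 0) = 0 := by
    rw [toRadialL2_of_memLp MemLp.zero']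
    exact MemLp.toLp_zero _
  rw [hz0, zero_add] at hgr
  have h3 := eq_zero_of_mem_graph_smul hk hgr
  have h4 : glue R (fun r => c * solF B i n k r) (fun r => d * solG B i n k r)
      =ᵐ[volume.restrict (Ioi (0 : ℝ))] 0 := by
    have := coeFn_toRadialL2 hm
    rw [h3] at this
    exact this.symm.trans (Lp.coeFn_zero _ _ _)
  have h5 : EqOn (fun r => c * solF B i n k r) 0 (Ioo 0 R) := by
    refine Measure.eqOn_open_of_ae_eq (μ := volume) ?_ isOpen_Ioo
      (continuous_const.mul (continuous_solF B i n k)).continuousOn continuousOn_const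
    filter_upwards [h4.filter_mono (ae_mono (Measure.restrict_mono Ioo_subset_Ioi_self le_rfl)),
      ae_restrict_mem measurableSet_Ioo] with r h5 h6
    rwa [glue, if_pos h6.2] at h5
  have h6 : EqOn (fun r => d * solG B i n k r) 0 (Ioi R) := by
    refine Measure.eqOn_open_of_ae_eq (μ := volume) ?_ isOpen_Ioi
      (continuousOn_const.mul (hG.continuousOn.mono (Ioi_subset_Ioi hR.le))) continuousOn_const
    filter_upwards [h4.filter_mono
      (ae_mono (Measure.restrict_mono (Ioi_subset_Ioi hR.le) le_rfl)),
      ae_restrict_mem measurableSet_Ioi] with r h5 h6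
    rwa [glue, if_neg (not_lt.2 (le_of_lt h6))] at h5
  have hc : c = 0 := by
    obtain ⟨r, h7, h8⟩ := ((eventually_solF_ne_zero B i n k).and
      (Ioo_mem_nhdsGT hR)).exists
    exact (mul_eq_zero.1 (h5 h8)).resolve_right h7
  have hd : d = 0 := by
    obtain ⟨r, h7, h8⟩ := ((eventually_solG_ne_zero hB i n k).and (eventually_gt_atTop R)).exists
    exact (mul_eq_zero.1 (h6 h8)).resolve_right h7
  exact hcd.elim (fun h => h hc) fun h => h hd

theorem kreinDenom_zero (B R : ℝ) (i : Fin 2) (n : ℤ) (k : ℂ) :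
    kreinDenom B R i n 0 k = wronskian B R i n k := by
  simp [kreinDenom, wronskian]

theorem wronskian_ne_zero {B R : ℝ} (hB : 0 < B) (hR : 0 < R) {i : Fin 2} {n : ℤ} {k : ℂ}
    (hk : k ∈ opResolventSet (radialOp B R i n 0)) : wronskian B R i n k ≠ 0 := by
  rw [← kreinDenom_zero]
  exact kreinDenom_ne_zero hB hR hk

/-- The equation has no first-order term, so the Wronskian is constant; normalization at `R`
therefore works at every `r`. -/
theorem wronskian_eq {B R : ℝ} (hB : 0 < B) (hR : 0 < R) (i : Fin 2) (n : ℤ) (k : ℂ) {r : ℝ}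
    (hr : 0 < r) : solG B i n k r * deriv (solF B i n k) r - deriv (solG B i n k) r *
      solF B i n k r = wronskian B R i n k := by
  have hF := isRadialSol_solF hB i n k
  have hG := isRadialSol_solG hB i n k
  have hd : ∀ r, 0 < r → HasDerivAt (fun r => solG B i n k r * deriv (solF B i n k) r -
      deriv (solG B i n k) r * solF B i n k r) 0 r := fun r hr =>
    (((hG.hasDerivAt r hr).mul (hF.hasDerivAt_deriv r hr)).sub
      ((hG.hasDerivAt_deriv r hr).mul (hF.hasDerivAt r hr))).congr_deriv (by ring)
  exact isOpen_Ioi.is_const_of_deriv_eq_zero isPreconnected_Ioi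
    (fun r hr => (hd r hr).differentiableAt.differentiableWithinAt)
    (fun r hr => (hd r hr).deriv) hr hR

end RadialResolvent

/-! ### Variation of constants and the resolvent on test functions -/

section RadialGreen

/-- The function `∫ g(k, r, r') f(r') dr'` in terms of primitives of `F f` and `G f`. -/
def greenFun (B R : ℝ) (i : Fin 2) (n : ℤ) (k : ℂ) (f : ℝ → ℂ) (r : ℝ) : ℂ :=
  normM B R i n k * (solG B i n k r * (∫ t in (0 : ℝ)..r, solF B i n k t * f t) +
    solF B i n k r * ((∫ t in Ioi (0 : ℝ), solG B i n k t * f t) -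
      ∫ t in (0 : ℝ)..r, solG B i n k t * f t))

/-- Nothing is assumed about `g` on `(-∞, 0]`; the support of `f` hides it, so that primitives based
at `0` are available for `g = G`. -/
theorem continuous_mul_of_tsupport_subset {g f : ℝ → ℂ} (hg : ContinuousOn g (Ioi 0))
    (hf : Continuous f) (hs : tsupport f ⊆ Ioi 0) : Continuous fun r => g r * f r :=
  (hg.mul hf.continuousOn).continuous_of_tsupport_subset isOpen_Ioi
    ((closure_mono (Function.support_mul_subset_right g f)).trans hs)

/-- Common form of the integrals against the Green kernel, split at `r`, and against `φ`, split at
`R`. -/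
theorem integral_piecewise_mul {F G f h : ℝ → ℂ} {a c : ℂ} {r : ℝ} (hr : 0 < r)
    (hF : Continuous fun t => F t * f t) (hG : Continuous fun t => G t * f t)
    (hc : HasCompactSupport f) (h1 : ∀ t, 0 < t → t < r → h t = a * F t)
    (h2 : ∀ t, r < t → h t = c * G t) :
    ∫ t in Ioi (0 : ℝ), h t * f t = a * (∫ t in (0 : ℝ)..r, F t * f t) +
      c * ((∫ t in Ioi (0 : ℝ), G t * f t) - ∫ t in (0 : ℝ)..r, G t * f t) := by
  have iF : Integrable (fun t => F t * f t) := hF.integrable_of_hasCompactSupport hc.mul_left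
  have iG : Integrable (fun t => G t * f t) := hG.integrable_of_hasCompactSupport hc.mul_left
  have hne : ∀ᵐ x : ℝ, x ≠ r := by simp [ae_iff, measure_singleton]
  have e1 : (fun t => a * (F t * f t)) =ᵐ[volume.restrict (Ioc 0 r)] fun t => h t * f t := by
    filter_upwards [ae_restrict_of_ae hne, ae_restrict_mem measurableSet_Ioc] with t ht ht'
    rw [h1 t ht'.1 (lt_of_le_of_ne ht'.2 ht)]
    ring
  have e2 : (fun t => c * (G t * f t)) =ᵐ[volume.restrict (Ioi r)] fun t => h t * f t := by
    filter_upwards [ae_restrict_mem measurableSet_Ioi] with t ht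
    rw [h2 t ht]
    ring
  have i1 : IntegrableOn (fun t => h t * f t) (Ioc 0 r) :=
    (Integrable.congr (iF.const_mul a).integrableOn e1)
  have i2 : IntegrableOn (fun t => h t * f t) (Ioi r) :=
    (Integrable.congr (iG.const_mul c).integrableOn e2)
  rw [← Ioc_union_Ioi_eq_Ioi hr.le, setIntegral_union (Ioc_disjoint_Ioi le_rfl) measurableSet_Ioi
    i1 i2, ← integral_congr_ae e1, ← integral_congr_ae e2, integral_const_mul, integral_const_mul,
    setIntegral_union (Ioc_disjoint_Ioi le_rfl) measurableSet_Ioi iG.integrableOn iG.integrableOn,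
    intervalIntegral.integral_of_le hr.le, intervalIntegral.integral_of_le hr.le,
    add_sub_cancel_left]

theorem continuous_solF_mul (B : ℝ) (i : Fin 2) (n : ℤ) (k : ℂ) {f : ℝ → ℂ} (hf : Continuous f) :
    Continuous fun r => solF B i n k r * f r :=
  (continuous_solF B i n k).mul hf

variable {B R : ℝ} (hB : 0 < B) (hR : 0 < R) (i : Fin 2) (n : ℤ) (k : ℂ)
  {f : ℝ → ℂ} (hf : Continuous f) (hc : HasCompactSupport f) (hs : tsupport f ⊆ Ioi 0)

include hB hf hs

theorem continuous_solG_mul : Continuous fun r => solG B i n k r * f r :=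
  continuous_mul_of_tsupport_subset (isRadialSol_solG hB i n k).continuousOn hf hs

/-- The terms from differentiating the primitives are `G F f` and `-F G f`, which cancel. -/
theorem hasDerivAt_greenFun (R : ℝ) {r : ℝ} (hr : 0 < r) : HasDerivAt (greenFun B R i n k f)
    (normM B R i n k * (deriv (solG B i n k) r * (∫ t in (0 : ℝ)..r, solF B i n k t * f t) +
      deriv (solF B i n k) r * ((∫ t in Ioi (0 : ℝ), solG B i n k t * f t) -
        ∫ t in (0 : ℝ)..r, solG B i n k t * f t))) r := by
  have hF := (isRadialSol_solF hB i n k).hasDerivAt r hr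
  have hG := (isRadialSol_solG hB i n k).hasDerivAt r hr
  have hp := (continuous_solF_mul B i n k hf).integral_hasStrictDerivAt 0 r |>.hasDerivAt
  have hq := (continuous_solG_mul hB i n k hf hs).integral_hasStrictDerivAt 0 r |>.hasDerivAt
  exact (((hG.mul hp).add (hF.mul (hq.const_sub _))).const_mul _).congr_deriv (by ring)

include hR in
-- In the second derivative the primitives contribute `M (G' F - F' G) f`, which is `-f` by
-- constancy of the Wronskian.
theorem isInhomSol_greenFun (hW : wronskian B R i n k ≠ 0) :
    IsInhomSol (radialCoeff B i n k) f (greenFun B R i n k f) := by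
  refine IsInhomSol.of_hasDerivAt (fun r hr => hasDerivAt_greenFun hB i n k hf hs R hr)
    fun r hr => ?_
  have hF := (isRadialSol_solF hB i n k).hasDerivAt_deriv r hr
  have hG := (isRadialSol_solG hB i n k).hasDerivAt_deriv r hr
  have hp := (continuous_solF_mul B i n k hf).integral_hasStrictDerivAt 0 r |>.hasDerivAt
  have hq := (continuous_solG_mul hB i n k hf hs).integral_hasStrictDerivAt 0 r |>.hasDerivAt
  refine (((hG.mul hp).add (hF.mul (hq.const_sub _))).const_mul _).congr_deriv ?_
  have hw := wronskian_eq hB hR i n k hr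
  have hM : normM B R i n k * wronskian B R i n k = 1 := inv_mul_cancel₀ hW
  rw [greenFun]
  linear_combination -normM B R i n k * f r * hw - f r * hM

include hc in
-- Below the support of `f` both primitives vanish, above it they equal the full integrals. Square
-- integrability and the origin condition are thus inherited from `F` and `G`.
theorem exists_greenFun_eq_ends (R : ℝ) : ∃ a b : ℝ, ∃ c d : ℂ, 0 < a ∧
    (∀ r, 0 < r → r < a → greenFun B R i n k f r = c * solF B i n k r) ∧
    ∀ r, b < r → greenFun B R i n k f r = d * solG B i n k r := by
  obtain ⟨a, b, ha, hab⟩ : ∃ a b : ℝ, 0 < a ∧ ∀ r, f r ≠ 0 → a ≤ r ∧ r ≤ b := by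
    rcases (tsupport f).eq_empty_or_nonempty with h | h
    · refine ⟨1, 1, one_pos, fun r hr => ?_⟩
      exact absurd (subset_tsupport f hr) (by simp [h])
    · obtain ⟨a, ha⟩ := hc.isCompact.exists_isLeast h
      obtain ⟨b, hb⟩ := hc.isCompact.exists_isGreatest h
      exact ⟨a, b, hs ha.1, fun r hr => ⟨ha.2 (subset_tsupport f hr), hb.2 (subset_tsupport f hr)⟩⟩
  have hlo : ∀ (g : ℝ → ℂ) (r : ℝ), 0 < r → r < a → ∫ t in (0 : ℝ)..r, g t * f t = 0 := by
    intro g r h0 hr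
    rw [intervalIntegral.integral_of_le h0.le]
    refine setIntegral_eq_zero_of_forall_eq_zero fun t ht => ?_
    have : f t = 0 := by
      by_contra h
      exact absurd (hab t h).1 (not_le.2 (ht.2.trans_lt hr))
    rw [this, mul_zero]
  have iG : Integrable (fun t => solG B i n k t * f t) :=
    (continuous_solG_mul hB i n k hf hs).integrable_of_hasCompactSupport hc.mul_left
  have iF : Integrable (fun t => solF B i n k t * f t) :=
    (continuous_solF_mul B i n k hf).integrable_of_hasCompactSupport hc.mul_left
  have hhi : ∀ (g : ℝ → ℂ) (r : ℝ), 0 < r → b < r → Integrable (fun t => g t * f t) →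
      ∫ t in (0 : ℝ)..r, g t * f t = ∫ t in Ioi (0 : ℝ), g t * f t := by
    intro g r h0 hr hi
    rw [intervalIntegral.integral_of_le h0.le, ← Ioc_union_Ioi_eq_Ioi h0.le,
      setIntegral_union (Ioc_disjoint_Ioi le_rfl) measurableSet_Ioi hi.integrableOn
      hi.integrableOn]
    have h1 : ∫ t in Ioi r, g t * f t = 0 := by
      refine setIntegral_eq_zero_of_forall_eq_zero fun t ht => ?_
      have : f t = 0 := by
        by_contra h
        exact absurd (hab t h).2 (not_le.2 (hr.trans ht))
      rw [this, mul_zero]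
    rw [h1, add_zero]
  refine ⟨a, max b 0, normM B R i n k * ∫ t in Ioi (0 : ℝ), solG B i n k t * f t,
    normM B R i n k * ∫ t in Ioi (0 : ℝ), solF B i n k t * f t, ha, fun r h0 hr => ?_,
    fun r hr => ?_⟩
  · rw [greenFun, hlo _ r h0 hr, hlo _ r h0 hr]
    ring
  · have h0 : 0 < r := (le_max_right _ _).trans_lt hr
    have hb : b < r := (le_max_left _ _).trans_lt hr
    rw [greenFun, hhi _ r h0 hb iG, hhi _ r h0 hb iF]
    ring

include hc in
theorem memLp_greenFun (R : ℝ) :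
    MemLp (greenFun B R i n k f) 2 (volume.restrict (Ioi (0 : ℝ))) := by
  obtain ⟨a, b, c, d, ha, h1, h2⟩ := exists_greenFun_eq_ends hB i n k hf hc hs R
  -- `b` itself may fail to be positive, and square integrability of `G` is known only on half-lines
  -- starting at a positive point.
  refine memLp_of_eq_ends (b := max b a) ha (fun r hr =>
    (hasDerivAt_greenFun hB i n k hf hs R hr).continuousAt.continuousWithinAt)
    (memLp_solF B i n k a) (memLp_solG hB i n k (ha.trans_le (le_max_right _ _))) h1
    fun r hr => h2 r ((le_max_left _ _).trans_lt hr)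

include hc in
theorem originCondition_greenFun (R : ℝ) : OriginCondition n (greenFun B R i n k f) := by
  obtain ⟨a, b, c, d, ha, h1, -⟩ := exists_greenFun_eq_ends hB i n k hf hc hs R
  intro hn
  refine (originCondition_const_mul_solF B i n k c hn).congr' ?_
  filter_upwards [Ioo_mem_nhdsGT ha] with r hr
  rw [h1 r hr.1 hr.2]

include hR hc in
/-- The resolvent of the operator with a `δ'`-condition, on continuous functions of compact
support. -/
theorem opResolvent_radialOp_toRadialL2 {γ : ℝ} (hW : wronskian B R i n k ≠ 0)
    (hk : k ∈ opResolventSet (radialOp B R i n γ)) :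
    opResolvent (radialOp B R i n γ) k (toRadialL2 f) = toRadialL2 (greenFun B R i n k f) +
      (kreinCoeff B R i n γ k * deriv (greenFun B R i n k f) R) •
        toRadialL2 (phi B R i n k) := by
  -- With `u = greenFun`, `φ` has jump `1` and derivative `M G' F'` at `R`, so this `c` solves the
  -- jump condition `c = γ (u'(R) + c M G' F')` for `u + c φ`.
  set c := kreinCoeff B R i n γ k * deriv (greenFun B R i n k f) R with hcdef
  have hu := isInhomSol_greenFun hB hR i n k hf hs hW
  have hF := isRadialSol_solF hB i n k
  have hG := isRadialSol_solG hB i n k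
  set g1 := fun r => greenFun B R i n k f r +
    (c * (normM B R i n k * deriv (solG B i n k) R)) * solF B i n k r with hg1
  set g2 := fun r => greenFun B R i n k f r +
    (c * (normM B R i n k * deriv (solF B i n k) R)) * solG B i n k r with hg2
  have hm1 := memLp_greenFun hB i n k hf hc hs R
  have hm2 := memLp_phi hB hR i n k
  -- Each branch of `φ` is extended to the whole half-line, so that `g1` and `g2` are global
  -- solutions fit for gluing.
  have hsum : glue R g1 g2 = greenFun B R i n k f + c • phi B R i n k := by
    ext r
    simp only [glue, hg1, hg2, phi, Pi.add_apply, Pi.smul_apply, smul_eq_mul]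
    split_ifs <;> ring
  have hm : MemLp (glue R g1 g2) 2 (volume.restrict (Ioi (0 : ℝ))) := by
    rw [hsum]
    exact hm1.add (hm2.const_smul c)
  have e1 : deriv g1 R = _ := hu.deriv_add_const_mul hF _ hR
  have e2 : deriv g2 R = _ := hu.deriv_add_const_mul hG _ hR
  have hD := kreinDenom_ne_zero hB hR hk
  have hM0 : normM B R i n k ≠ 0 := inv_ne_zero hW
  have hM : normM B R i n k * wronskian B R i n k = 1 := inv_mul_cancel₀ hW
  have hD' : kreinDenom B R i n γ k = wronskian B R i n k -
    γ * deriv (solG B i n k) R * deriv (solF B i n k) R := rfl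
  have hcoef : kreinCoeff B R i n γ k * (normM B R i n k * kreinDenom B R i n γ k) = γ :=
    div_mul_cancel₀ _ (mul_ne_zero hM0 hD)
  have hgr := glue_mem_graph (γ := γ) hR hf ((hf.memLp_of_hasCompactSupport hc).restrict _)
    (hu.add_const_mul hF _) (hu.add_const_mul hG _) hm (by rw [e1, e2]; ring)
    (by
      rw [e1]
      rw [hD'] at hcoef
      have hw : solG B i n k R * deriv (solF B i n k) R - deriv (solG B i n k) R *
        solF B i n k R = wronskian B R i n k := rfl
      rw [hcdef]
      linear_combination deriv (greenFun B R i n k f) R * hcoef +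
        kreinCoeff B R i n γ k * deriv (greenFun B R i n k f) R * normM B R i n k * hw)
    (by
      intro hn
      have h1 := (originCondition_greenFun hB i n k hf hc hs R hn).add
        (originCondition_const_mul_solF B i n k
          (c * (normM B R i n k * deriv (solG B i n k) R)) hn)
      rw [add_zero] at h1
      exact h1.congr fun r => (add_div _ _ _).symm)
  rw [opResolvent_eq_of_mem_graph hk hgr, toRadialL2_of_memLp hm, toRadialL2_of_memLp hm1,
    toRadialL2_of_memLp hm2, ← MemLp.toLp_const_smul, ← MemLp.toLp_add, MemLp.toLp_eq_toLp_iff,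
    hsum]

end RadialGreen

/-! ### Extension to all of `L²`, spinors and the plane -/

section ResolventFormulas

variable {B R : ℝ} (hB : 0 < B) (hR : 0 < R) (i : Fin 2) (n : ℤ)

include hB in
theorem memLp_green (R : ℝ) (k : ℂ) {r : ℝ} (hr : 0 < r) :
    MemLp (green B R i n k r) 2 (volume.restrict (Ioi (0 : ℝ))) :=
  memLp_Ioi_of_split ((memLp_solF B i n k r).const_mul (normM B R i n k * solG B i n k r))
    ((memLp_solG hB i n k hr).const_mul (normM B R i n k * solF B i n k r))
    (fun _ _ ht => if_pos ht.le) fun _ ht => if_neg (not_le.2 ht)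

include hB in
theorem integral_green_mul (R : ℝ) (k : ℂ) {f : ℝ → ℂ} (hf : Continuous f)
    (hc : HasCompactSupport f) (hs : tsupport f ⊆ Ioi 0) {r : ℝ} (hr : 0 < r) :
    ∫ t in Ioi (0 : ℝ), green B R i n k r t * f t = greenFun B R i n k f r := by
  rw [integral_piecewise_mul (h := green B R i n k r) (F := solF B i n k)
    (G := solG B i n k)
    (a := normM B R i n k * solG B i n k r) (c := normM B R i n k * solF B i n k r) hr
    (continuous_solF_mul B i n k hf) (continuous_solG_mul hB i n k hf hs) hc
    (fun _ _ ht => if_pos ht.le) fun _ ht => if_neg (not_le.2 ht), greenFun]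
  ring

include hB hR in
-- `φ` represents the functional that sends `f` to the derivative at `R` of the free solution; this
-- turns the coefficient found from the jump condition into a scalar product.
theorem integral_phi_mul (k : ℂ) {f : ℝ → ℂ} (hf : Continuous f)
    (hc : HasCompactSupport f) (hs : tsupport f ⊆ Ioi 0) :
    ∫ t in Ioi (0 : ℝ), phi B R i n k t * f t = deriv (greenFun B R i n k f) R := by
  rw [integral_piecewise_mul (h := phi B R i n k) (F := solF B i n k)
    (G := solG B i n k)
    (a := normM B R i n k * deriv (solG B i n k) R)
    (c := normM B R i n k * deriv (solF B i n k) R) hR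
    (continuous_solF_mul B i n k hf) (continuous_solG_mul hB i n k hf hs) hc
    (fun _ _ ht => if_pos ht) (fun _ ht => if_neg (not_lt.2 ht.le)),
    (hasDerivAt_greenFun hB i n k hf hs R hR).deriv]
  ring

include hB hR in
theorem inner_phi_conj (k : ℂ) (v : RadialL2) :
    ⟪toRadialL2 (phi B R i n (conj k)), v⟫_ℂ = ∫ r in Ioi (0 : ℝ), phi B R i n k r * v r := by
  rw [inner_toRadialL2 (memLp_phi hB hR i n (conj k))]
  refine setIntegral_congr_fun measurableSet_Ioi fun r hr => ?_
  rw [phi_conj hB hR i n k hr, Complex.conj_conj]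

theorem setIntegral_mul_toRadialL2 (g : ℝ → ℂ) {f : ℝ → ℂ} (hf : Continuous f)
    (hc : HasCompactSupport f) :
    ∫ r in Ioi (0 : ℝ), g r * toRadialL2 f r = ∫ r in Ioi (0 : ℝ), g r * f r := by
  refine integral_congr_ae ?_
  filter_upwards [coeFn_toRadialL2 ((hf.memLp_of_hasCompactSupport hc).restrict (Ioi 0))]
    with r hr
  rw [hr]

include hB hR in
theorem opResolvent_radialOp_free {k : ℂ} (hk : k ∈ opResolventSet (radialOp B R i n 0))
    {f : ℝ → ℂ} (hf : Continuous f) (hc : HasCompactSupport f) (hs : tsupport f ⊆ Ioi 0) :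
    opResolvent (radialOp B R i n 0) k (toRadialL2 f) = toRadialL2 (greenFun B R i n k f) := by
  rw [opResolvent_radialOp_toRadialL2 hB hR i n k hf hc hs (wronskian_ne_zero hB hR hk) hk]
  simp [kreinCoeff]

include hB hR in
theorem opResolvent_radialOp_ae_eq {k : ℂ} (hk : k ∈ opResolventSet (radialOp B R i n 0))
    (v : RadialL2) : ∀ᵐ r ∂(volume.restrict (Ioi (0 : ℝ))),
      opResolvent (radialOp B R i n 0) k v r = ∫ t in Ioi (0 : ℝ), green B R i n k r t * v t := by
  -- The kernel is conjugated because the scalar product is antilinear in its first slot.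
  have hin : ∀ r, 0 < r → ∀ v : RadialL2,
      ⟪toRadialL2 (fun t => conj (green B R i n k r t)), v⟫_ℂ =
        ∫ t in Ioi (0 : ℝ), green B R i n k r t * v t := fun r hr v => by
    have hm : MemLp (fun t => conj (green B R i n k r t)) 2 (volume.restrict (Ioi (0 : ℝ))) :=
      (memLp_green hB i n R k hr).star
    rw [inner_toRadialL2 hm]
    simp
  have := ae_eq_inner_of_continuous (opResolvent (radialOp B R i n 0) k)
    (fun r => toRadialL2 fun t => conj (green B R i n k r t)) (fun f hf hc hs => by
      rw [opResolvent_radialOp_free hB hR i n hk hf hc hs]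
      filter_upwards [coeFn_toRadialL2 (memLp_greenFun hB i n k hf hc hs R),
        ae_restrict_mem measurableSet_Ioi] with r h1 hr
      rw [h1, hin r hr, setIntegral_mul_toRadialL2 _ hf hc,
        integral_green_mul hB i n R k hf hc hs hr]) v
  filter_upwards [this, ae_restrict_mem measurableSet_Ioi] with r h1 hr
  rw [h1, hin r hr]

include hB hR in
-- Both sides are bounded operators, the correction being of rank at most one, and they agree on the
-- dense set of test functions.
theorem opResolvent_radialOp_krein {γ : ℝ} {k : ℂ}
    (hk : k ∈ opResolventSet (radialOp B R i n γ))
    (hk0 : k ∈ opResolventSet (radialOp B R i n 0)) (v : RadialL2) :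
    opResolvent (radialOp B R i n γ) k v = opResolvent (radialOp B R i n 0) k v +
      (kreinCoeff B R i n γ k * ⟪toRadialL2 (phi B R i n (conj k)), v⟫_ℂ) •
        toRadialL2 (phi B R i n k) := by
  have h : opResolvent (radialOp B R i n γ) k = opResolvent (radialOp B R i n 0) k +
      (kreinCoeff B R i n γ k • innerSL ℂ (toRadialL2 (phi B R i n (conj k)))).smulRight
        (toRadialL2 (phi B R i n k)) := by
    refine continuousLinearMap_ext_of_continuous fun f hf hc hs => ?_
    rw [opResolvent_radialOp_toRadialL2 hB hR i n k hf hc hs (wronskian_ne_zero hB hR hk0) hk,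
      add_apply, opResolvent_radialOp_free hB hR i n hk0 hf hc hs,
      ContinuousLinearMap.smulRight_apply, smul_apply, innerSL_apply_apply,
      inner_phi_conj hB hR, setIntegral_mul_toRadialL2 _ hf hc,
      integral_phi_mul hB hR i n k hf hc hs, smul_eq_mul]
  rw [h, add_apply, ContinuousLinearMap.smulRight_apply, smul_apply, innerSL_apply_apply,
    smul_eq_mul]

include hB hR in
-- For `r ≠ R` all `ρ` near `R` lie on the same side of `r`, so a single branch of the kernel is
-- differentiated.
theorem hasDerivAt_green (k : ℂ) {r : ℝ} (hne : r ≠ R) :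
    HasDerivAt (fun ρ : ℝ => green B R i n k ρ r) (phi B R i n k r) R := by
  have hF := (isRadialSol_solF hB i n k).hasDerivAt R hR
  have hG := (isRadialSol_solG hB i n k).hasDerivAt R hR
  rcases lt_or_gt_of_ne hne with h | h
  · rw [phi, if_pos h]
    refine ((hG.const_mul (normM B R i n k)).mul_const (solF B i n k r)).congr_of_eventuallyEq ?_
    filter_upwards [Ioi_mem_nhds h] with ρ hρ using if_pos (le_of_lt hρ)
  · rw [phi, if_neg (not_lt.2 h.le)]
    refine ((hF.const_mul (normM B R i n k)).mul_const (solG B i n k r)).congr_of_eventuallyEq ?_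
    filter_upwards [Iio_mem_nhds h] with ρ hρ using if_neg (not_le.2 hρ)

omit i n

variable {ℓ : Fin 2 → ℤ} {γ : Fin 2 → ℝ} {k : ℂ}

theorem inner_Psi (ℓ : Fin 2 → ℤ) (i : Fin 2) (k : ℂ) (f : RadialSpinor) :
    ⟪Psi B R ℓ i k, f⟫_ℂ = ⟪toRadialL2 (phi B R i (ℓ i) k), f i⟫_ℂ := by
  rw [PiLp.inner_apply, Finset.sum_eq_single i]
  · rw [Psi, PiLp.single_eq_same]
  · intro j _ hj
    rw [Psi, PiLp.single_eq_of_ne 2 hj, inner_zero_left]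
  · simp

include hB hR in
theorem opResolvent_spinorRadialOp_krein
    (hk : k ∈ opResolventSet (spinorRadialOp B R ℓ γ))
    (hk0 : k ∈ opResolventSet (spinorRadialOp B R ℓ 0)) (f : RadialSpinor) :
    opResolvent (spinorRadialOp B R ℓ γ) k f = opResolvent (spinorRadialOp B R ℓ 0) k f +
      ∑ i : Fin 2, ∑ j : Fin 2,
        (kreinMatrix B R ℓ γ k i j * ⟪Psi B R ℓ i (conj k), f⟫_ℂ) • Psi B R ℓ j k := by
  ext1 l
  have h := opResolvent_radialOp_krein hB hR l (ℓ l) (mem_opResolventSet_of_diagOp hk l)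
    (mem_opResolventSet_of_diagOp hk0 l) (f l)
  rw [PiLp.add_apply, spinorRadialOp, spinorRadialOp, opResolvent_diagOp_apply hk,
    opResolvent_diagOp_apply hk0, h]
  congr 1
  simp only [inner_Psi]
  fin_cases l <;> simp [Fin.sum_univ_two, kreinMatrix, Psi]

include hB hR in
theorem opResolvent_spinorRadialOp_green
    (hk : k ∈ opResolventSet (spinorRadialOp B R ℓ 0)) (f : RadialSpinor) (i : Fin 2) :
    (∀ r : ℝ, 0 < r → ∀ j : Fin 2,
      IntegrableOn (fun r' => greenMatrix B R ℓ k r r' i j * f j r') (Ioi 0)) ∧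
    ∀ᵐ r ∂(volume.restrict (Ioi (0 : ℝ))), (opResolvent (spinorRadialOp B R ℓ 0) k f) i r =
      ∑ j : Fin 2, ∫ r' in Ioi (0 : ℝ), greenMatrix B R ℓ k r r' i j * f j r' := by
  constructor
  · intro r hr j
    by_cases hij : i = j
    · subst hij
      simp only [greenMatrix, Matrix.diagonal_apply_eq]
      exact integrable_mul_radialL2 (memLp_green hB i (ℓ i) R k hr) (f i)
    · simp only [greenMatrix, Matrix.diagonal_apply_ne _ hij, zero_mul]
      exact integrableOn_zero
  · rw [spinorRadialOp, opResolvent_diagOp_apply hk]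
    filter_upwards [opResolvent_radialOp_ae_eq hB hR i (ℓ i) (mem_opResolventSet_of_diagOp hk i)
      (f i)] with r hr
    rw [Finset.sum_eq_single i]
    · simp only [greenMatrix, Matrix.diagonal_apply_eq]
      exact hr
    · intro j _ hij
      simp [greenMatrix, Matrix.diagonal_apply_ne _ hij.symm]
    · simp

theorem opResolvent_planeOp_spinorEmbedding {γ : Fin 2 → ℤ → ℝ}
    (hk : k ∈ opResolventSet (planeOp B R γ)) (ℓ : Fin 2 → ℤ) :
    k ∈ opResolventSet (spinorRadialOp B R ℓ fun i => γ i (ℓ i)) ∧ ∀ f : RadialSpinor,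
      opResolvent (planeOp B R γ) k (spinorEmbedding ℓ f) =
        spinorEmbedding ℓ (opResolvent (spinorRadialOp B R ℓ fun i => γ i (ℓ i)) k f) := by
  have h : k ∈ opResolventSet (spinorRadialOp B R ℓ fun i => γ i (ℓ i)) :=
    mem_opResolventSet_diagOp fun i =>
      mem_opResolventSet_of_directSumOp modeEmbedding_orthogonal hk (i, ℓ i)
  refine ⟨h, fun f => ?_⟩
  rw [spinorEmbedding, spinorEmbedding, map_sum]
  refine Finset.sum_congr rfl fun i _ => ?_
  rw [spinorRadialOp, opResolvent_diagOp_apply h]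
  exact opResolvent_directSumOp_apply modeEmbedding_orthogonal hk (i, ℓ i) (f i)

include hB hR in
-- The expansion of `ψ` into modes is mapped termwise by the two bounded resolvents; on each mode
-- their difference is the rank-one radial correction. Bounded maps preserve unconditional
-- convergence, so no estimate on the coefficients is needed.
theorem hasSum_opResolvent_planeOp {γ : Fin 2 → ℤ → ℝ}
    (hk : k ∈ opResolventSet (planeOp B R γ)) (hk0 : k ∈ opResolventSet (planeOp B R 0))
    (ψ : PlaneSpinor) :
    HasSum (fun p : Fin 2 × ℤ => (kreinCoeff B R p.1 p.2 (γ p.1 p.2) k *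
        ⟪modeEmbedding p (toRadialL2 (phi B R p.1 p.2 (conj k))), ψ⟫_ℂ) •
          modeEmbedding p (toRadialL2 (phi B R p.1 p.2 k)))
      (opResolvent (planeOp B R γ) k ψ - opResolvent (planeOp B R 0) k ψ) := by
  have h1 := hasSum_adjoint_of_mem_opResolventSet modeEmbedding_orthogonal hk0 ψ
  have h2 := (h1.mapL (opResolvent (planeOp B R γ) k)).sub
    (h1.mapL (opResolvent (planeOp B R 0) k))
  refine hasSum_of_forall_eq (fun p => ?_) h2
  rw [planeOp, planeOp, opResolvent_directSumOp_apply modeEmbedding_orthogonal hk,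
    opResolvent_directSumOp_apply modeEmbedding_orthogonal hk0, ← map_sub,
    opResolvent_radialOp_krein hB hR p.1 p.2
      (mem_opResolventSet_of_directSumOp modeEmbedding_orthogonal hk p)
      (mem_opResolventSet_of_directSumOp modeEmbedding_orthogonal hk0 p)]
  simp only [Pi.zero_apply, add_sub_cancel_left, map_smul]
  rw [ContinuousLinearMap.adjoint_inner_right]
  rfl

end ResolventFormulas

end

end LandauCylinder

theorem mainTheorem3 (B R : ℝ) (hB : 0 < B) (hR : 0 < R) (α β : ℤ → ℝ) :
    (∀ (m m' : ℤ) (k : ℂ),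
      k ∈ opResolventSet
        (spinorRadialOp B R ![m, m'] ![α m, β m']) →
      k ∈ opResolventSet (spinorRadialOp B R ![m, m'] 0) →
      -- all quantities in the formulas are meaningful
      (∀ i : Fin 2,
        wronskian B R i (![m, m'] i) k ≠ 0 ∧
        kreinDenom B R i (![m, m'] i) (![α m, β m'] i) k ≠ 0 ∧
        MemLp (phi B R i (![m, m'] i) k) 2 (volume.restrict (Ioi (0 : ℝ))) ∧
        MemLp (phi B R i (![m, m'] i) (conj k)) 2
          (volume.restrict (Ioi (0 : ℝ)))) ∧
      -- the resolvent formula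
      (∀ f : RadialSpinor,
        opResolvent
            (spinorRadialOp B R ![m, m'] ![α m, β m']) k f =
          opResolvent (spinorRadialOp B R ![m, m'] 0) k f +
            ∑ i : Fin 2, ∑ j : Fin 2,
              (kreinMatrix B R ![m, m'] ![α m, β m'] k i j *
                ⟪Psi B R ![m, m'] i (conj k), f⟫_ℂ) •
                  Psi B R ![m, m'] j k) ∧
      -- the Green function of the free operator
      (∀ (f : RadialSpinor) (i : Fin 2),
        (∀ r : ℝ, 0 < r → ∀ j : Fin 2, IntegrableOn
          (fun r' => greenMatrix B R ![m, m'] k r r' i j * f j r') (Ioi 0)) ∧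
        ∀ᵐ r ∂(volume.restrict (Ioi (0 : ℝ))),
          (opResolvent (spinorRadialOp B R ![m, m'] 0) k f) i r =
            ∑ j : Fin 2, ∫ r' in Ioi (0 : ℝ),
              greenMatrix B R ![m, m'] k r r' i j * f j r') ∧
      -- its derivative at the circle
      (∀ (i : Fin 2) (r : ℝ), 0 < r → r ≠ R →
        HasDerivAt (fun ρ : ℝ => green B R i (![m, m'] i) k ρ r)
          (phi B R i (![m, m'] i) k r) R)) ∧
    (∀ k : ℂ,
      k ∈ opResolventSet (planeOp B R ![α, β]) →
      k ∈ opResolventSet (planeOp B R 0) →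
      -- the resolvents are the direct sums of the radial resolvents
      (∀ m m' : ℤ,
        k ∈ opResolventSet
          (spinorRadialOp B R ![m, m'] ![α m, β m']) ∧
        k ∈ opResolventSet (spinorRadialOp B R ![m, m'] 0) ∧
        ∀ f : RadialSpinor,
          opResolvent (planeOp B R ![α, β]) k
              (spinorEmbedding ![m, m'] f) =
            spinorEmbedding ![m, m'] (opResolvent
              (spinorRadialOp B R ![m, m'] ![α m, β m']) k f) ∧
          opResolvent (planeOp B R 0) k
              (spinorEmbedding ![m, m'] f) =
            spinorEmbedding ![m, m'] (opResolvent
              (spinorRadialOp B R ![m, m'] 0) k f)) ∧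
      -- the resolvent formula in the plane
      ∀ ψ : PlaneSpinor,
        HasSum (fun p : Fin 2 × ℤ =>
            (kreinCoeff B R p.1 p.2 ((![α, β] : Fin 2 → ℤ → ℝ) p.1 p.2) k *
              ⟪modeEmbedding p (toRadialL2
                (phi B R p.1 p.2 (conj k))), ψ⟫_ℂ) •
              modeEmbedding p (toRadialL2
                (phi B R p.1 p.2 k)))
          (opResolvent (planeOp B R ![α, β]) k ψ -
            opResolvent (planeOp B R 0) k ψ)) := by
  -- The couplings of one pair of modes are the family of the plane operator evaluated at `(m, m')`,
  -- the form in which the direct sum supplies them.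
  have hγ : ∀ m m' : ℤ, (![α m, β m'] : Fin 2 → ℝ) =
      fun i => (![α, β] : Fin 2 → ℤ → ℝ) i (![m, m'] i) := by
    intro m m'
    funext i
    fin_cases i <;> rfl
  refine ⟨fun m m' k hk hk0 => ⟨fun i => ⟨?_, ?_, memLp_phi hB hR _ _ _, memLp_phi hB hR _ _ _⟩,
    opResolvent_spinorRadialOp_krein hB hR hk hk0, opResolvent_spinorRadialOp_green hB hR hk0,
    fun i r _ hne => hasDerivAt_green hB hR i _ k hne⟩,
    fun k hk hk0 => ⟨fun m m' => ?_, hasSum_opResolvent_planeOp hB hR hk hk0⟩⟩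
  · exact wronskian_ne_zero hB hR (mem_opResolventSet_of_diagOp hk0 i)
  · exact kreinDenom_ne_zero hB hR (mem_opResolventSet_of_diagOp hk i)
  · rw [hγ]
    obtain ⟨h1, h2⟩ := opResolvent_planeOp_spinorEmbedding hk ![m, m']
    obtain ⟨h3, h4⟩ := opResolvent_planeOp_spinorEmbedding hk0 ![m, m']
    exact ⟨h1, h3, fun f => ⟨h2 f, h4 f⟩⟩
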